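/- Let $k$ be a field and let $p\ge 1$, $n\ge 0$ be integers. Let $\Pi_{i_1\dots i_p}$ be the coordinates on $\bigwedge^p k^n$ with respect to the basis $e_{i_1}\wedge\cdots\wedge e_{i_p}$, $i_1<\cdots<i_p$, extended antisymmetrically to all $(i_1,\dots,i_p)\in\{1,\dots,n\}^p$. An element of $\bigwedge^p k^n$ is called decomposable if it equals $v_1\wedge\cdots\wedge v_p$ for some $v_i\in k^n$; the decomposable elements form the Grassmann cone. For $m\ge 0$ and indices in $\{1,\dots,n\}$ given by $\mathcal A=(\alpha_1,\dots,\alpha_4)$, $\mathcal B=((\beta_1^0,\beta_1^1),\dots,(\beta_m^0,\beta_m^1))$ and $\mathcal C=(\gamma_1,\dots,\gamma_{p-m-2})$, put $$P'_{\mathcal A,\mathcal B,\mathcal C}=\pi_{12}\pi_{34}-\pi_{13}\pi_{24}+\pi_{14}\pi_{23},\qquad \pi_{ij}=\sum_{\mu\in\{0,1\}^m}\Pi_{\alpha_i\alpha_j\beta_1^{\mu_1}\cdots\beta_m^{\mu_m}\gamma_1\cdots\gamma_{p-m-2}}.$$ Let $\mathcal P'(p,n)$ be the set of all quadratic forms $P'_{\mathcal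 A,\mathcal B,\mathcal C}$ on $\bigwedge^p k^n$ (with $0\le m\le p-2$) for which the indices $\alpha_i,\beta_j^\nu,\gamma_l$ are all distinct and satisfy $$\alpha_i<\alpha_{i+1},\quad \beta_i^0<\beta_i^1,\quad \beta_i^\nu<\beta_{i+1}^\nu,\quad \beta_i^0<\alpha_1,\quad \beta_i^1<\alpha_3,\quad \gamma_i<\gamma_{i+1}.$$ The rank of a quadratic form $Q$ is the codimension of its radical $\{x \mid Q(x+y)=Q(y)\text{ for all }y\}$. Then: 1. $\mathcal P'(p,n)$ is finite. 2. Every $Q\in\mathcal P'(p,n)$ has rank $6$, and $Q=P\circ G$, where $P=\Pi_{12}\Pi_{34}-\Pi_{13}\Pi_{24}+\Pi_{14}\Pi_{23}$ is the 3-term Plücker relation on $\bigwedge^2k^4$ and $G\colon\bigwedge^p k^n\to\bigwedge^2k^4$ is a linear map that sends decomposable elements to decomposable elements. 3. An element $\omega\in\bigwedge^p k^n$ is decomposable if and only if every form in $\mathcal P'(p,n)$ vanishes at $\omega$. 4. Likewise, $\omega\in\bigwedge^p k^n$ is decomposable if and only if all the usual Plücker relations $$P_{A,B}=\sum_{i=1}^{p+1}(-1)^{i-1}\,\Pi_{a_1\dots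 a_{p-1}b_i}\,\Pi_{b_1\dots b_{i-1}b_{i+1}\dots b_{p+1}}$$ vanish at $\omega$, where $a_1,\dots,a_{p-1}$ are distinct and $b_1,\dots,b_{p+1}$ are distinct elements of $\{1,\dots,n\}$. So the two sets of quadratic forms both cut out the Grassmann cone set-theoretically. -/

import Mathlib

open scoped BigOperators

namespace GrassmannCone

noncomputable section

/-- An element of `⋀ᵖ V` is decomposable if it is of the form `v₁ ∧ ⋯ ∧ v_p`. -/
def IsDecomposable {k V : Type*} [Field k] [AddCommGroup V] [Module k V] {p : ℕ}
    (ω : ⋀[k]^p V) : Prop :=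
  ∃ v : Fin p → V, ω = exteriorPower.ιMulti k p v

/-- A linear map between exterior powers preserves the Grassmann cone if it sends decomposable
elements to decomposable elements. -/
def PreservesGrassmannCone {k V W : Type*} [Field k] [AddCommGroup V] [Module k V]
    [AddCommGroup W] [Module k W] {p q : ℕ} (G : ⋀[k]^p V →ₗ[k] ⋀[k]^q W) : Prop :=
  ∀ ω : ⋀[k]^p V, IsDecomposable ω → IsDecomposable (G ω)

/-- The coordinate `Π_{i₁ … i_p}` on `⋀ᵖ kⁿ`, for an arbitrary sequence of indices: it sends
`v₁ ∧ ⋯ ∧ v_p` to the determinant of the matrix with entries `(v_a)_{i_b}`. The facts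
`coordinate_of_strictMono`, `coordinate_comp_perm` and `coordinate_of_not_injective` show that it
is the antisymmetric extension of the coordinates in the basis `e_{i₁} ∧ ⋯ ∧ e_{i_p}`,
`i₁ < ⋯ < i_p`. -/
def coordinate (k : Type*) [Field k] {p n : ℕ} (i : Fin p → Fin n) :
    ⋀[k]^p (Fin n → k) →ₗ[k] k :=
  exteriorPower.pairingDual k (Fin n → k) p
    (exteriorPower.ιMulti k p fun j => (LinearMap.proj (i j) : (Fin n → k) →ₗ[k] k))

theorem coordinate_ιMulti (k : Type*) [Field k] {p n : ℕ} (i : Fin p → Fin n)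
    (v : Fin p → Fin n → k) :
    coordinate k i (exteriorPower.ιMulti k p v) = (Matrix.of fun a b => v a (i b)).det := by
  simp [coordinate]

theorem coordinate_of_strictMono (k : Type*) [Field k] {p n : ℕ}
    (s : Set.powersetCard (Fin n) p) (ω : ⋀[k]^p (Fin n → k)) :
    coordinate k (Set.powersetCard.ofFinEmbEquiv.symm s) ω
      = ((Pi.basisFun k (Fin n)).exteriorPower p).repr ω s := by
  rw [exteriorPower.basis_repr_apply]
  rfl

theorem coordinate_comp_perm (k : Type*) [Field k] {p n : ℕ} (i : Fin p → Fin n)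
    (σ : Equiv.Perm (Fin p)) :
    coordinate k (i ∘ σ) = Equiv.Perm.sign σ • coordinate k i := by
  have h := (exteriorPower.ιMulti k p (M := (Fin n → k) →ₗ[k] k)).map_perm
    (fun j => (LinearMap.proj (i j) : (Fin n → k) →ₗ[k] k)) σ
  have h2 := congrArg (exteriorPower.pairingDual k (Fin n → k) p) h
  rw [Units.smul_def, map_zsmul] at h2
  rw [Units.smul_def]
  exact h2

theorem coordinate_of_not_injective (k : Type*) [Field k] {p n : ℕ} (i : Fin p → Fin n)
    (hi : ¬ Function.Injective i) : coordinate k i = 0 := by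
  have h : exteriorPower.ιMulti k p
      (fun j => (LinearMap.proj (i j) : (Fin n → k) →ₗ[k] k)) = 0 := by
    rw [Function.not_injective_iff] at hi
    obtain ⟨a, b, hab, hne⟩ := hi
    exact (exteriorPower.ιMulti k p (M := (Fin n → k) →ₗ[k] k)).map_eq_zero_of_eq _
      (by rw [hab]) hne
  rw [coordinate, h, map_zero]

/-- The usual Plücker relation
`P_{A,B} = ∑ᵢ (-1)ⁱ⁻¹ Π_{a₁ … a_{p-1} bᵢ} Π_{b₁ … b_{p+1} ∖ bᵢ}`, as a quadratic form on `⋀ᵖ kⁿ`;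
here `d = p - 1`, and indices start from zero. -/
def pluckerForm (k : Type*) [Field k] {d p n : ℕ} (h : d + 1 = p)
    (a : Fin d → Fin n) (b : Fin (p + 1) → Fin n) : QuadraticForm k (⋀[k]^p (Fin n → k)) :=
  ∑ i : Fin (p + 1), (-1 : k) ^ (i : ℕ) •
    QuadraticMap.linMulLin
      (coordinate k ((Fin.snoc a (b i) : Fin (d + 1) → Fin n) ∘ Fin.cast h.symm))
      (coordinate k (b ∘ i.succAbove))

/-- The usual Plücker relations `P_{A,B}` on `⋀ᵖ kⁿ`, for `A, B ⊆ {1, …, n}` with `|A| = p - 1` and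
`|B| = p + 1`, the elements of `A` and `B` being listed in any order. -/
def pluckerRelations (k : Type*) [Field k] (p n : ℕ) :
    Set (QuadraticForm k (⋀[k]^p (Fin n → k))) :=
  {Q | ∃ (d : ℕ) (h : d + 1 = p) (a : Fin d → Fin n) (b : Fin (p + 1) → Fin n),
    Function.Injective a ∧ Function.Injective b ∧ Q = pluckerForm k h a b}

/-- The expression `x₁₂ x₃₄ - x₁₃ x₂₄ + x₁₄ x₂₃` in six linear forms `xᵢⱼ`, `i < j`. -/
def threeTerm {k V : Type*} [Field k] [AddCommGroup V] [Module k V]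
    (x : Fin 4 → Fin 4 → V →ₗ[k] k) : QuadraticForm k V :=
  QuadraticMap.linMulLin (x 0 1) (x 2 3) - QuadraticMap.linMulLin (x 0 2) (x 1 3)
    + QuadraticMap.linMulLin (x 0 3) (x 1 2)

/-- The 3-term Plücker relation `Π₁₂ Π₃₄ - Π₁₃ Π₂₄ + Π₁₄ Π₂₃` on `⋀² k⁴`. -/
def threeTermPlucker (k : Type*) [Field k] : QuadraticForm k (⋀[k]^2 (Fin 4 → k)) :=
  threeTerm fun i j => coordinate k ![i, j]

/-- The index data `𝒜 = (α₁, …, α₄)`, `ℬ = ((β₁⁰, β₁¹), …, (β_m⁰, β_m¹))` and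
`𝒞 = (γ₁, …, γ_c)` in `{1, …, n}`, with `c = p - m - 2`. -/
structure IndexTriple (p n : ℕ) where
  m : ℕ
  c : ℕ
  card_eq : 2 + m + c = p
  α : Fin 4 → Fin n
  β : Fin m → Fin 2 → Fin n
  γ : Fin c → Fin n

namespace IndexTriple

variable {p n : ℕ} (T : IndexTriple p n)

/-- The index sequence `αᵢ αⱼ β₁^{μ₁} … β_m^{μ_m} γ₁ … γ_c`. -/
def indices (i j : Fin 4) (μ : Fin T.m → Fin 2) : Fin p → Fin n :=
  Fin.append (Fin.append ![T.α i, T.α j] fun l => T.β l (μ l)) T.γ ∘ Fin.cast T.card_eq.symm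

/-- The linear form `πᵢⱼ`, the sum over all choices `μ ∈ {0,1}ᵐ` of the coordinates
`Π_{αᵢ αⱼ β₁^{μ₁} … β_m^{μ_m} γ₁ … γ_c}`. -/
def pairForm (k : Type*) [Field k] (i j : Fin 4) : ⋀[k]^p (Fin n → k) →ₗ[k] k :=
  ∑ μ : Fin T.m → Fin 2, coordinate k (T.indices i j μ)

/-- The quadratic form `P'_{𝒜,ℬ,𝒞} = π₁₂ π₃₄ - π₁₃ π₂₄ + π₁₄ π₂₃`. -/
def form (k : Type*) [Field k] : QuadraticForm k (⋀[k]^p (Fin n → k)) :=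
  threeTerm (T.pairForm k)

/-- The indices `αᵢ`, `βⱼ^μ`, `γₗ` are all distinct and satisfy
`αᵢ < αᵢ₊₁`, `βᵢ⁰ < βᵢ¹`, `βᵢ^ν < βᵢ₊₁^ν`, `βᵢ⁰ < α₁`, `βᵢ¹ < α₃`, `γᵢ < γᵢ₊₁`. -/
structure IsOrdered : Prop where
  distinct : Function.Injective
    (Sum.elim T.α (Sum.elim (fun q : Fin T.m × Fin 2 => T.β q.1 q.2) T.γ))
  α_strictMono : StrictMono T.α
  β_lt : ∀ i, T.β i 0 < T.β i 1
  β_strictMono : ∀ ν, StrictMono fun i => T.β i ν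
  β_zero_lt : ∀ i, T.β i 0 < T.α 0
  β_one_lt : ∀ i, T.β i 1 < T.α 2
  γ_strictMono : StrictMono T.γ

end IndexTriple

/-- The set `𝒫'(p,n)` of the quadratic forms `P'_{𝒜,ℬ,𝒞}` for all ordered index data. -/
def rankSixForms (k : Type*) [Field k] (p n : ℕ) :
    Set (QuadraticForm k (⋀[k]^p (Fin n → k))) :=
  {Q | ∃ T : IndexTriple p n, T.IsOrdered ∧ Q = T.form k}

/-- The rank of a quadratic form over a field of any characteristic: the codimension of its
radical `{x | ∀ y, Q (x + y) = Q y}`. If the characteristic is not two, this is the rank of the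
symmetric matrix of `Q`. -/
def formRank {k V : Type*} [Field k] [AddCommGroup V] [Module k V] (Q : QuadraticForm k V) : ℕ :=
  Module.finrank k (V ⧸ Q.radical)

end

end GrassmannCone

/-! Everything rests on the exchange relations `Π_s Π_t = ∑_b Π_{s[a←t_b]} Π_{t[b←s_a]}`. The
coordinates of a decomposable element are minors of one matrix, and for them the relation is
Cramer's rule. Conversely, if `Π_s(ω) ≠ 0`, some decomposable `η` agrees with `ω` at `s` and at all
sequences differing from `s` in one place (`exists_isDecomposable_forall_update`). Exchange
relations determine all other coordinates by induction on the distance from `s`, so they force `ω =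
η` (`SatisfiesExchange.eq_of_forall_update`). Up to sign they are Plücker relations, which settles
the classical statement.

The form `πᵢⱼ` is the pairing with `x_{αᵢ} ∧ x_{αⱼ} ∧ ⋀(x_{β⁰} + x_{β¹}) ∧ ⋀ x_γ`. Hence `G = (πᵢⱼ)`
is a contraction with `p - 2` covectors followed by the map induced by a projection `kⁿ → k⁴`, and
it preserves the cone. The six `πᵢⱼ`, `i < j`, are independent, so the rank is 6 in every
characteristic.

Suppose all forms of rank six vanish at `ω`. With `s` and `η` as above, `Π_t(ω) = Π_t(η)` is shown
by induction on the distance `d` from `s` to `t`. For `d = 2`, the form with `m = 0` determines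
`Π_t`. For `d ≥ 3`, if some neighbour of `s` in the direction of `t` has a nonzero coordinate, it
replaces `s`. Otherwise many coordinates of `η` vanish, and the form with `m = d - 2` separating `s`
from `t` collapses to `± Π_s Π_t`, so `Π_t(ω) = 0 = Π_t(η)`. -/

namespace GrassmannCone

/-! ### Exchange of rows between two determinants -/

section Exchange

/-- The exchange identity for a product of two determinants, given by their rows. -/
theorem det_mul_det_eq_sum_exchange {m R : Type*} [Fintype m] [DecidableEq m] [CommRing R]
    (s t : m → m → R) (a : m) :
    (Matrix.of s).det * (Matrix.of t).det
      = ∑ b, (Matrix.of (Function.update s a (t b))).det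
          * (Matrix.of (Function.update t b (s a))).det := by
  -- Cramer's rule expresses `det t • s a` as a combination of the rows of `t`; applying the
  -- determinant of `s` as a linear function `L` of row `a` gives the identity.
  have h := Matrix.mulVec_cramer (Matrix.of t).transpose (s a)
  let L := (Matrix.detRowAlternating (n := m) (R := R)).toMultilinearMap.toLinearMap s a
  have hL : ∀ x, L x = (Matrix.of (Function.update s a x)).det := fun x => rfl
  have h2 : (Matrix.of t).transpose.mulVec (Matrix.cramer (Matrix.of t).transpose (s a))
      = ∑ b, (Matrix.of (Function.update t b (s a))).det • t b := by
    funext r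
    simp only [Matrix.mulVec, dotProduct, Matrix.cramer_transpose_apply, Finset.sum_apply,
      Pi.smul_apply, smul_eq_mul, Matrix.transpose_apply, Matrix.of_apply]
    refine Finset.sum_congr rfl fun b _ => ?_
    rw [mul_comm]
    rfl
  have h3 := congrArg L (h2.symm.trans h)
  rw [map_sum, map_smul, Matrix.det_transpose, hL, Function.update_eq_self, smul_eq_mul] at h3
  rw [mul_comm, ← h3]
  refine Finset.sum_congr rfl fun b _ => ?_
  rw [map_smul, hL, smul_eq_mul, mul_comm]

end Exchange

/-! ### Exchange relations characterise decomposable elements -/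

section Coordinates

variable {k : Type*} [Field k] {p n : ℕ}

/-- An injective sequence with entries among those of another one is a rearrangement of it. -/
theorem exists_perm_of_forall_mem_range {X : Type*} {w s : Fin p → X}
    (hw : Function.Injective w) (h : ∀ c, w c ∈ Set.range s) :
    ∃ σ : Equiv.Perm (Fin p), w = s ∘ σ := by
  choose g hg using h
  have hgi : Function.Injective g := fun a b hab => hw (by rw [← hg a, ← hg b, hab])
  exact ⟨Equiv.ofBijective g (Finite.injective_iff_bijective.mp hgi), funext fun c => (hg c).symm⟩

theorem coordinate_comp_perm_apply (i : Fin p → Fin n) (σ : Equiv.Perm (Fin p))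
    (ω : ⋀[k]^p (Fin n → k)) :
    coordinate k (i ∘ σ) ω = ((Equiv.Perm.sign σ : ℤ) : k) * coordinate k i ω := by
  rw [coordinate_comp_perm, Units.smul_def, LinearMap.smul_apply, zsmul_eq_mul]

theorem sign_mul_self (σ : Equiv.Perm (Fin p)) :
    ((Equiv.Perm.sign σ : ℤ) : k) * ((Equiv.Perm.sign σ : ℤ) : k) = 1 := by
  rw [← Int.cast_mul, ← Units.val_mul, Int.units_mul_self]
  simp

theorem coordinate_apply_of_not_injective {i : Fin p → Fin n} (hi : ¬ Function.Injective i)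
    (ω : ⋀[k]^p (Fin n → k)) : coordinate k i ω = 0 := by
  rw [coordinate_of_not_injective k i hi, LinearMap.zero_apply]

/-- Up to sign, a coordinate depends only on the set of its indices. -/
theorem exists_sign_of_forall_mem_range {w s : Fin p → Fin n} (hw : Function.Injective w)
    (h : ∀ c, w c ∈ Set.range s) : ∃ ε : k, ε * ε = 1 ∧
      ∀ ω : ⋀[k]^p (Fin n → k), coordinate k w ω = ε * coordinate k s ω := by
  obtain ⟨σ, rfl⟩ := exists_perm_of_forall_mem_range hw h
  exact ⟨_, sign_mul_self σ, coordinate_comp_perm_apply s σ⟩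

theorem coordinate_update_eq_zero {s : Fin p → Fin n} {a b : Fin p} (hab : b ≠ a)
    (ω : ⋀[k]^p (Fin n → k)) : coordinate k (Function.update s a (s b)) ω = 0 := by
  refine coordinate_apply_of_not_injective (fun h => hab ?_) ω
  exact h (by simp [hab])

theorem ext_coordinate {ω η : ⋀[k]^p (Fin n → k)}
    (h : ∀ i : Fin p → Fin n, Function.Injective i → coordinate k i ω = coordinate k i η) :
    ω = η := by
  refine ((Pi.basisFun k (Fin n)).exteriorPower p).repr.injective (Finsupp.ext fun s => ?_)
  rw [← coordinate_of_strictMono, ← coordinate_of_strictMono]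
  exact h _ (Set.powersetCard.ofFinEmbEquiv.symm s).injective

theorem exists_coordinate_ne_zero {ω : ⋀[k]^p (Fin n → k)} (h : ω ≠ 0) :
    ∃ i : Fin p → Fin n, Function.Injective i ∧ coordinate k i ω ≠ 0 := by
  by_contra! hc
  exact h (ext_coordinate fun i hi => by rw [hc i hi, map_zero])

theorem coordinate_injective_of_ne_zero {s : Fin p → Fin n} {ω : ⋀[k]^p (Fin n → k)}
    (h : coordinate k s ω ≠ 0) : Function.Injective s := by
  by_contra hs
  exact h (coordinate_apply_of_not_injective hs ω)

/-- The exchange relations between the coordinates of `ω`. -/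
def SatisfiesExchange (ω : ⋀[k]^p (Fin n → k)) : Prop :=
  ∀ (s t : Fin p → Fin n) (a : Fin p), Function.Injective s → Function.Injective t →
    s a ∉ Set.range t →
    coordinate k s ω * coordinate k t ω
      = ∑ b, coordinate k (Function.update s a (t b)) ω
          * coordinate k (Function.update t b (s a)) ω

theorem coordinate_ιMulti_eq_det_rows (v : Fin p → Fin n → k) (i : Fin p → Fin n) :
    coordinate k i (exteriorPower.ιMulti k p v) = (Matrix.of fun b a => v a (i b)).det := by
  rw [coordinate_ιMulti, ← Matrix.det_transpose]
  rfl

/-- No condition on `s`, `t`, `a` is needed here, whereas `SatisfiesExchange` keeps only the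
instances that Plücker relations with distinct indices supply. -/
theorem IsDecomposable.exchange {ω : ⋀[k]^p (Fin n → k)} (h : IsDecomposable ω)
    (s t : Fin p → Fin n) (a : Fin p) :
    coordinate k s ω * coordinate k t ω
      = ∑ b, coordinate k (Function.update s a (t b)) ω
          * coordinate k (Function.update t b (s a)) ω := by
  obtain ⟨v, rfl⟩ := h
  simp only [coordinate_ιMulti_eq_det_rows]
  rw [det_mul_det_eq_sum_exchange (fun b c => v c (s b)) (fun b c => v c (t b)) a]
  refine Finset.sum_congr rfl fun b _ => ?_
  congr 3 <;> · funext c; simp only [Function.update_apply]; split_ifs <;> rfl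

theorem IsDecomposable.satisfiesExchange {ω : ⋀[k]^p (Fin n → k)} (h : IsDecomposable ω) :
    SatisfiesExchange ω := fun s t a _ _ _ => h.exchange s t a

/-- The number of entries of `t` that are not entries of `s`. -/
noncomputable def indexDist (s t : Fin p → Fin n) : ℕ := {b | t b ∉ Set.range s}.ncard

theorem exists_notMem_range {s t : Fin p → Fin n} (hs : Function.Injective s) {b : Fin p}
    (hb : t b ∉ Set.range s) : ∃ a, s a ∉ Set.range t := by
  by_contra! h
  obtain ⟨σ, rfl⟩ := exists_perm_of_forall_mem_range hs h
  exact hb ⟨σ.symm b, by simp⟩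

/-- The hypothesis gives an injection from the entries of `t'` outside `s` to those of `t` outside
`s`, and it misses `b`. -/
theorem indexDist_lt {s t t' : Fin p → Fin n} {b : Fin p} (hb : t b ∉ Set.range s)
    (ht' : Function.Injective t')
    (h : ∀ c, t' c ∉ Set.range s → ∃ d, d ≠ b ∧ t d = t' c) : indexDist s t' < indexDist s t := by
  have h1 : ∀ c ∈ {c | t' c ∉ Set.range s}, ∃ d, d ≠ b ∧ t d = t' c := fun c hc => h c hc
  choose! g hg using h1
  have hle : {c | t' c ∉ Set.range s}.ncard ≤ ({c | t c ∉ Set.range s} \ {b}).ncard := by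
    refine Set.ncard_le_ncard_of_injOn g (fun c hc => ⟨?_, ?_⟩) (fun c hc d hd hcd => ?_)
      (Set.toFinite _)
    · show t (g c) ∉ _
      rw [(hg c hc).2]
      exact hc
    · exact (hg c hc).1
    · exact ht' (by rw [← (hg c hc).2, ← (hg d hd).2, hcd])
  refine lt_of_le_of_lt hle (Set.ncard_lt_ncard ?_ (Set.toFinite _))
  exact Set.sdiff_singleton_ssubset.mpr hb

/-- In the exchange relation for `s` and `t`, each nonzero term is a neighbour of `s` times a
coordinate strictly closer to `s`. Division by `Π_s` therefore determines `Π_t` by induction on the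
distance. -/
theorem SatisfiesExchange.eq_of_forall_update {ω η : ⋀[k]^p (Fin n → k)}
    (hω : SatisfiesExchange ω) (hη : SatisfiesExchange η) {s : Fin p → Fin n}
    (h0 : coordinate k s ω ≠ 0) (hs : coordinate k s ω = coordinate k s η)
    (h : ∀ a x, coordinate k (Function.update s a x) ω = coordinate k (Function.update s a x) η) :
    ω = η := by
  have hsi := coordinate_injective_of_ne_zero h0
  have key : ∀ d, ∀ t : Fin p → Fin n, indexDist s t = d →
      coordinate k t ω = coordinate k t η := by
    intro d
    induction d using Nat.strong_induction_on with
    | _ d ih =>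
      intro t htd
      by_cases hti : Function.Injective t
      swap
      · simp only [coordinate_apply_of_not_injective hti]
      by_cases hb : ∀ c, t c ∈ Set.range s
      · obtain ⟨ε, -, he⟩ := exists_sign_of_forall_mem_range (k := k) hti hb
        rw [he, he, hs]
      push Not at hb
      obtain ⟨b0, hb0⟩ := hb
      obtain ⟨a, ha⟩ := exists_notMem_range hsi hb0
      have e1 := hω s t a hsi hti ha
      have e2 := hη s t a hsi hti ha
      have e3 : coordinate k s ω * coordinate k t ω = coordinate k s ω * coordinate k t η := by
        rw [e1, hs, e2]
        refine Finset.sum_congr rfl fun b _ => ?_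
        by_cases hbs : t b ∈ Set.range s
        · obtain ⟨c, hc⟩ := hbs
          have hca : c ≠ a := by
            rintro rfl
            exact ha ⟨b, hc.symm⟩
          rw [← hc, coordinate_update_eq_zero hca, coordinate_update_eq_zero hca, zero_mul,
            zero_mul]
        · rw [h]
          congr 1
          by_cases hi : Function.Injective (Function.update t b (s a))
          swap
          · simp only [coordinate_apply_of_not_injective hi]
          refine ih _ ?_ _ rfl
          rw [← htd]
          refine indexDist_lt hbs hi fun c hc => ⟨c, ?_, ?_⟩
          · rintro rfl
            simp at hc
          · rw [Function.update_of_ne]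
            rintro rfl
            simp at hc
      exact mul_left_cancel₀ h0 e3
  exact ext_coordinate fun i _ => key _ i rfl

theorem isDecomposable_smul_ιMulti {V : Type*} [AddCommGroup V] [Module k V] (hp : 1 ≤ p)
    (c : k) (v : Fin p → V) : IsDecomposable (c • exteriorPower.ιMulti k p v) := by
  refine ⟨Function.update v ⟨0, hp⟩ (c • v ⟨0, hp⟩), ?_⟩
  rw [AlternatingMap.map_update_smul, Function.update_eq_self]

theorem isDecomposable_zero {V : Type*} [AddCommGroup V] [Module k V] (hp : 1 ≤ p) :
    IsDecomposable (0 : ⋀[k]^p V) := by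
  have := isDecomposable_smul_ιMulti (k := k) hp 0 (0 : Fin p → V)
  rwa [zero_smul] at this

/-- Near a nonzero coordinate, every element agrees with a decomposable one. -/
theorem exists_isDecomposable_forall_update (hp : 1 ≤ p) {ω : ⋀[k]^p (Fin n → k)}
    {s : Fin p → Fin n} (h0 : coordinate k s ω ≠ 0) :
    ∃ η : ⋀[k]^p (Fin n → k), IsDecomposable η ∧ ∀ a x,
      coordinate k (Function.update s a x) η = coordinate k (Function.update s a x) ω := by
  set c := coordinate k s ω with hc
  -- Affine chart `Π_s ≠ 0`: the matrix is normalised so that its columns `s` form the identity, and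
  -- its other entries are forced by the neighbours of `s`.
  let v : Fin p → Fin n → k := fun a x => c⁻¹ * coordinate k (Function.update s a x) ω
  have hv : ∀ a b, v a (s b) = (1 : Matrix (Fin p) (Fin p) k) a b := by
    intro a b
    by_cases hab : b = a
    · subst hab
      simp [v, ← hc, h0]
    · simp [v, coordinate_update_eq_zero hab, Matrix.one_apply_ne (Ne.symm hab)]
  refine ⟨c • exteriorPower.ιMulti k p v, isDecomposable_smul_ιMulti hp c v, fun a x => ?_⟩
  rw [map_smul, coordinate_ιMulti]
  have : (Matrix.of fun r b => v r (Function.update s a x b))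
      = (1 : Matrix (Fin p) (Fin p) k).updateCol a (fun r => v r x) := by
    ext r b
    rw [Matrix.of_apply, Matrix.updateCol_apply, Function.update_apply]
    split_ifs
    · rfl
    · exact hv r b
  rw [this, ← Matrix.cramer_apply, Matrix.cramer_one]
  simp [v, h0]

theorem isDecomposable_of_satisfiesExchange (hp : 1 ≤ p) {ω : ⋀[k]^p (Fin n → k)}
    (h : SatisfiesExchange ω) : IsDecomposable ω := by
  by_cases h0 : ω = 0
  · rw [h0]
    exact isDecomposable_zero hp
  obtain ⟨s, -, hs⟩ := exists_coordinate_ne_zero h0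
  obtain ⟨η, hη, he⟩ := exists_isDecomposable_forall_update hp hs
  rw [h.eq_of_forall_update hη.satisfiesExchange hs ?_ fun a x => (he a x).symm]
  · exact hη
  · have := he ⟨0, hp⟩ (s ⟨0, hp⟩)
    rw [Function.update_eq_self] at this
    exact this.symm

end Coordinates

/-! ### Plücker relations as exchange relations -/

section Plucker

variable {k : Type*} [Field k] {d n : ℕ}

/-- The sign depends on `a` only, so it factors out of the whole Plücker sum. -/
theorem coordinate_snoc (a : Fin (d + 1)) : ∃ ε : k, ε * ε = 1 ∧
    ∀ (s : Fin (d + 1) → Fin n) (x : Fin n) (ω : ⋀[k]^(d + 1) (Fin n → k)),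
      coordinate k (Fin.snoc (s ∘ a.succAbove) x : Fin (d + 1) → Fin n) ω
        = ε * coordinate k (Function.update s a x) ω := by
  have hinj : Function.Injective (Fin.snoc a.succAbove a : Fin (d + 1) → Fin (d + 1)) := by
    rw [Fin.snoc_injective_iff]
    exact ⟨Fin.succAbove_right_injective, by simp⟩
  let τ : Equiv.Perm (Fin (d + 1)) := Equiv.ofBijective _ (Finite.injective_iff_bijective.mp hinj)
  refine ⟨_, sign_mul_self τ, fun s x ω => ?_⟩
  rw [← coordinate_comp_perm_apply]
  congr 2
  funext c
  refine Fin.lastCases ?_ (fun c => ?_) c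
  · simp [τ]
  · simp [τ]

theorem coordinate_cons_removeNth (t : Fin (d + 1) → Fin n) (b : Fin (d + 1)) (y : Fin n)
    (ω : ⋀[k]^(d + 1) (Fin n → k)) :
    coordinate k ((Fin.cons y t : Fin (d + 2) → Fin n) ∘ b.succ.succAbove) ω
      = (-1) ^ (b : ℕ) * coordinate k (Function.update t b y) ω := by
  have : ((Fin.cons y t : Fin (d + 2) → Fin n) ∘ b.succ.succAbove)
      = Function.update t b y ∘ b.cycleRange.symm := by
    funext c
    refine Fin.cases ?_ (fun c => ?_) c
    · simp
    · simp
  rw [this, coordinate_comp_perm_apply, Equiv.Perm.sign_symm, Fin.sign_cycleRange]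
  simp

/-- With `A = s ∖ s_a` and `B = (s_a, t)`, the first term is `Π_s Π_t`. In term `b + 1`, moving
`s_a` into place `b` costs `(-1)^b`, which leaves the sign `-1` throughout. -/
theorem pluckerForm_apply_eq (a : Fin (d + 1)) : ∃ ε : k, ε * ε = 1 ∧
    ∀ (s t : Fin (d + 1) → Fin n) (ω : ⋀[k]^(d + 1) (Fin n → k)),
      pluckerForm k rfl (s ∘ a.succAbove) (Fin.cons (s a) t) ω
        = ε * (coordinate k s ω * coordinate k t ω
          - ∑ b, coordinate k (Function.update s a (t b)) ω
              * coordinate k (Function.update t b (s a)) ω) := by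
  obtain ⟨ε, hε, he⟩ := coordinate_snoc (k := k) (n := n) a
  refine ⟨ε, hε, fun s t ω => ?_⟩
  rw [pluckerForm, sum_apply, Fin.sum_univ_succ]
  simp only [smul_apply, QuadraticMap.linMulLin_apply, Fin.cast_refl,
    Function.comp_id, Fin.cons_zero, Fin.cons_succ, Fin.val_succ, Fin.val_zero, pow_zero, one_smul,
    coordinate_cons_removeNth, smul_eq_mul, he]
  rw [Function.update_eq_self, mul_sub, Finset.mul_sum, sub_eq_add_neg, ← Finset.sum_neg_distrib]
  congr 1
  · rw [mul_assoc]
    congr 2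
  · refine Finset.sum_congr rfl fun b _ => ?_
    have : ((-1 : k) ^ (b : ℕ)) * (-1) ^ (b : ℕ) = 1 := by
      rw [← mul_pow]
      simp
    rw [pow_succ]
    linear_combination (-ε * coordinate k (Function.update s a (t b)) ω
      * coordinate k (Function.update t b (s a)) ω) * this

/-- The usual Plücker relations cut out the Grassmann cone. -/
theorem isDecomposable_iff_pluckerRelations {p : ℕ} (hp : 1 ≤ p) (ω : ⋀[k]^p (Fin n → k)) :
    IsDecomposable ω ↔ ∀ Q ∈ pluckerRelations k p n, Q ω = 0 := by
  constructor
  · rintro hω Q ⟨d, rfl, a, b, -, -, rfl⟩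
    obtain ⟨ε, -, he⟩ := pluckerForm_apply_eq (k := k) (n := n) (0 : Fin (d + 1))
    -- Any `P_{A,B}` arises at position 0 by moving `b 0` from `B` to the front of `A`.
    have := he (Fin.cons (b 0) a) (Fin.tail b) ω
    rw [← hω.exchange, sub_self, mul_zero] at this
    convert this using 2
    rw [Fin.cons_zero, Fin.cons_self_tail]
    congr 1
  · intro h
    refine isDecomposable_of_satisfiesExchange hp fun s t a hs ht hst => ?_
    obtain ⟨d, rfl⟩ : ∃ d, p = d + 1 := ⟨p - 1, by omega⟩
    obtain ⟨ε, hε, he⟩ := pluckerForm_apply_eq (k := k) (n := n) a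
    have h1 := h _ ⟨d, rfl, s ∘ a.succAbove, Fin.cons (s a) t,
      hs.comp Fin.succAbove_right_injective, Fin.cons_injective_iff.mpr ⟨hst, ht⟩, rfl⟩
    rw [he] at h1
    have hε0 : ε ≠ 0 := by
      rintro rfl
      simp at hε
    exact sub_eq_zero.mp ((mul_eq_zero.mp h1).resolve_left hε0)

end Plucker

/-! ### The rank of a three-term form -/

section Rank

variable {k V : Type*} [Field k] [AddCommGroup V] [Module k V]

theorem threeTerm_apply (x : Fin 4 → Fin 4 → V →ₗ[k] k) (v : V) :
    threeTerm x v = x 0 1 v * x 2 3 v - x 0 2 v * x 1 3 v + x 0 3 v * x 1 2 v := rfl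

/-- The six linear forms occurring in `threeTerm x`. -/
def threeTermForms (x : Fin 4 → Fin 4 → V →ₗ[k] k) : Fin 6 → V →ₗ[k] k :=
  ![x 0 1, x 2 3, x 0 2, x 1 3, x 0 3, x 1 2]

/-- The six forms occur in three products, so testing the radical on the vector dual to one factor
isolates the other factor. Hence the radical is the common kernel. Radical vectors also satisfy `Q m
= 0`, so no division by two occurs. -/
theorem formRank_threeTerm (x : Fin 4 → Fin 4 → V →ₗ[k] k) (y : Fin 6 → V)
    (h : ∀ q r, threeTermForms x q (y r) = if q = r then 1 else 0) :
    formRank (threeTerm x) = 6 := by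
  have hsurj : Function.Surjective (LinearMap.pi (threeTermForms x)) := by
    intro c
    refine ⟨∑ r, c r • y r, funext fun q => ?_⟩
    simp [h]
  have hrad : (threeTerm x).radical = LinearMap.ker (LinearMap.pi (threeTermForms x)) := by
    ext m
    rw [QuadraticMap.mem_radical_iff', LinearMap.mem_ker]
    constructor
    · rintro ⟨h0, h1⟩
      have hy := fun r => h1 (y r)
      simp only [threeTerm_apply, map_add] at h0 hy
      have e := h
      simp only [Fin.forall_fin_succ, threeTermForms, Matrix.cons_val] at e hy
      simp [Fin.ext_iff] at e hy
      funext q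
      simp only [LinearMap.pi_apply, Pi.zero_apply]
      obtain ⟨hy0, hy1, hy2, hy3, hy4, hy5⟩ := hy
      simp only [e] at hy0 hy1 hy2 hy3 hy4 hy5
      fin_cases q
      · show x 0 1 m = 0
        linear_combination hy1 - h0
      · show x 2 3 m = 0
        linear_combination hy0 - h0
      · show x 0 2 m = 0
        linear_combination h0 - hy3
      · show x 1 3 m = 0
        linear_combination h0 - hy2
      · show x 0 3 m = 0
        linear_combination hy5 - h0
      · show x 1 2 m = 0
        linear_combination hy4 - h0
    · intro hm
      have hq : ∀ q, threeTermForms x q m = 0 := fun q => congrFun hm q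
      have h01 : x 0 1 m = 0 := hq 0
      have h23 : x 2 3 m = 0 := hq 1
      have h02 : x 0 2 m = 0 := hq 2
      have h13 : x 1 3 m = 0 := hq 3
      have h03 : x 0 3 m = 0 := hq 4
      have h12 : x 1 2 m = 0 := hq 5
      simp [threeTerm_apply, *]
  rw [formRank, hrad, (LinearMap.quotKerEquivOfSurjective _ hsurj).finrank_eq]
  simp

end Rank

/-! ### Maps to the bivectors of a four-dimensional space -/

section ConePreserving

variable {k : Type*} [Field k]

theorem ext_coordinate_of_strictMono {p n : ℕ} {ω η : ⋀[k]^p (Fin n → k)}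
    (h : ∀ i : Fin p → Fin n, StrictMono i → coordinate k i ω = coordinate k i η) : ω = η := by
  refine ((Pi.basisFun k (Fin n)).exteriorPower p).repr.injective (Finsupp.ext fun s => ?_)
  rw [← coordinate_of_strictMono, ← coordinate_of_strictMono]
  exact h _ (Set.powersetCard.ofFinEmbEquiv.symm s).strictMono

/-- The linear map to `⋀² k⁴` with the given coordinates. -/
noncomputable def toPlane {V : Type*} [AddCommGroup V] [Module k V]
    (x : Fin 4 → Fin 4 → V →ₗ[k] k) : V →ₗ[k] ⋀[k]^2 (Fin 4 → k) :=
  ∑ i, ∑ j, if i < j then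
    (x i j).smulRight (exteriorPower.ιMulti k 2 ![Pi.single i (1 : k), Pi.single j 1]) else 0

theorem coordinate_pair_ιMulti (u w : Fin 4 → k) (i j : Fin 4) :
    coordinate k ![i, j] (exteriorPower.ιMulti k 2 ![u, w]) = u i * w j - u j * w i := by
  rw [coordinate_ιMulti, Matrix.det_fin_two]
  simp

theorem coordinate_toPlane {V : Type*} [AddCommGroup V] [Module k V]
    (x : Fin 4 → Fin 4 → V →ₗ[k] k) {i j : Fin 4} (hij : i < j) (v : V) :
    coordinate k ![i, j] (toPlane x v) = x i j v := by
  have key : ∀ a b : Fin 4, coordinate k ![i, j] ((if a < b then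
    (x a b).smulRight (exteriorPower.ιMulti k 2 ![Pi.single a (1 : k), Pi.single b 1])
      else 0) v) = if a = i then (if b = j then x i j v else 0) else 0 := by
    intro a b
    by_cases hab : a < b
    · rw [if_pos hab, LinearMap.smulRight_apply, map_smul, coordinate_pair_ιMulti]
      by_cases ha : a = i
      · subst ha
        by_cases hb : b = j
        · subst hb
          simp [hab.ne]
        · simp [hb, Ne.symm hb, hab.ne, hij.ne']
      · rw [if_neg ha]
        have h2 : ¬ (j = a ∧ i = b) := by
          rintro ⟨rfl, rfl⟩
          exact lt_asymm hab hij
        rw [not_and_or] at h2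
        rcases h2 with h2 | h2 <;> simp [Pi.single_apply, Ne.symm ha, h2]
    · rw [if_neg hab]
      have : ¬ (a = i ∧ b = j) := by
        rintro ⟨rfl, rfl⟩
        exact hab hij
      rw [not_and_or] at this
      rcases this with h | h <;> simp [h]
  simp only [toPlane, LinearMap.sum_apply, map_sum, key]
  simp

theorem toPlane_eq_ιMulti {V : Type*} [AddCommGroup V] [Module k V]
    {x : Fin 4 → Fin 4 → V →ₗ[k] k} {v : V} {u w : Fin 4 → k}
    (h : ∀ i j, x i j v = u i * w j - u j * w i) :
    toPlane x v = exteriorPower.ιMulti k 2 ![u, w] := by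
  refine ext_coordinate_of_strictMono fun i hi => ?_
  have : i = ![i 0, i 1] := by
    funext a
    fin_cases a <;> rfl
  rw [this, coordinate_toPlane x (hi (by decide)), coordinate_pair_ιMulti, h]

theorem threeTermPlucker_comp_toPlane {V : Type*} [AddCommGroup V] [Module k V]
    (x : Fin 4 → Fin 4 → V →ₗ[k] k) : (threeTermPlucker k).comp (toPlane x) = threeTerm x := by
  ext v
  rw [QuadraticMap.comp_apply, threeTermPlucker, threeTerm_apply, threeTerm_apply]
  iterate 6 rw [coordinate_toPlane x (by decide)]

theorem threeTermPlucker_ιMulti (v : Fin 2 → Fin 4 → k) :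
    threeTermPlucker k (exteriorPower.ιMulti k 2 v) = 0 := by
  have : v = ![v 0, v 1] := by
    funext a
    fin_cases a <;> rfl
  rw [this, threeTermPlucker, threeTerm_apply]
  simp only [coordinate_pair_ιMulti]
  ring

/-- The determinant as a function of two rows satisfies the three-term relation. -/
theorem det_update_update_mul {m : Type*} [Fintype m] [DecidableEq m] (r : m → m → k) {a b : m}
    (hab : a ≠ b) (x y x' y' : m → k) :
    (Matrix.of (Function.update (Function.update r a x) b y)).det
        * (Matrix.of (Function.update (Function.update r a x') b y')).det
      = (Matrix.of (Function.update (Function.update r a x') b y)).det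
          * (Matrix.of (Function.update (Function.update r a x) b y')).det
        - (Matrix.of (Function.update (Function.update r a y') b y)).det
          * (Matrix.of (Function.update (Function.update r a x) b x')).det := by
  rw [det_mul_det_eq_sum_exchange _ _ a]
  -- All rows other than `a` and `b` are common to both matrices, so exchanging one of them in
  -- creates a repeated row.
  rw [Finset.sum_eq_add_of_mem a b (Finset.mem_univ _) (Finset.mem_univ _) hab]
  · have e1 : ∀ z, Function.update (Function.update (Function.update r a x) b y) a z
        = Function.update (Function.update r a z) b y := fun z => by
      rw [Function.update_comm hab, Function.update_idem]
      exact Function.update_comm hab.symm _ _ _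
    have e2 : Function.update (Function.update (Function.update r a x') b y') a x
        = Function.update (Function.update r a x) b y' := by
      rw [Function.update_comm hab, Function.update_idem]
      exact Function.update_comm hab.symm _ _ _
    have e3 : (Matrix.of (Function.update (Function.update r a x') b x)).det
        = - (Matrix.of (Function.update (Function.update r a x) b x')).det := by
      have h := (Matrix.detRowAlternating (n := m) (R := k)).map_swap
        (Function.update (Function.update r a x) b x') hab
      refine Eq.trans (congrArg Matrix.det ?_) h
      ext c l
      rcases eq_or_ne c b with rfl | hcb
      · simp [hab]
      rcases eq_or_ne c a with rfl | hca
      · simp [hab]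
      · simp [Equiv.swap_apply_of_ne_of_ne hca hcb, hca, hcb]
    simp only [Function.update_self, Function.update_of_ne hab, Function.update_idem, e1, e2, e3]
    ring
  · intro c _ hc
    have h0 : (Matrix.of (Function.update (Function.update (Function.update r a x) b y) a
        (Function.update (Function.update r a x') b y' c))).det = 0 := by
      refine Matrix.det_zero_of_row_eq hc.1 ?_
      funext l
      simp [hc.1, hc.2]
    rw [h0, zero_mul]

end ConePreserving

/-! ### The forms `πᵢⱼ` as pairings with wedge products -/

namespace IndexTriple

variable {k : Type*} [Field k] {p n : ℕ} (T : IndexTriple p n)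

/-- The covectors `x`, `y`, `x_{β_l⁰} + x_{β_l¹}`, `x_{γ_l}`. Their wedge product, with `x` and `y`
the coordinates `αᵢ` and `αⱼ`, is the linear form `πᵢⱼ`. -/
noncomputable def covectors (k : Type*) [Field k] (x y : (Fin n → k) →ₗ[k] k) :
    Fin p → (Fin n → k) →ₗ[k] k :=
  Fin.append (Fin.append ![x, y] fun l => ∑ ν, LinearMap.proj (T.β l ν))
    (fun l => LinearMap.proj (T.γ l)) ∘ Fin.cast T.card_eq.symm

theorem append_update_left {m c : ℕ} {X : Type*} (a : Fin m → X) (b : Fin c → X) (l : Fin m)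
    (x : X) : Fin.append (Function.update a l x) b
      = Function.update (Fin.append a b) (Fin.castAdd c l) x := by
  funext i
  refine Fin.addCases (fun i => ?_) (fun i => ?_) i
  · simp [Function.update_apply]
  · simp only [Fin.append_right]
    rw [Function.update_of_ne, Fin.append_right]
    simp [Fin.ext_iff]
    omega

theorem append_update_right {m c : ℕ} {X : Type*} (a : Fin m → X) (b : Fin c → X) (l : Fin c)
    (x : X) : Fin.append a (Function.update b l x)
      = Function.update (Fin.append a b) (Fin.natAdd m l) x := by
  funext i
  refine Fin.addCases (fun i => ?_) (fun i => ?_) i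
  · simp only [Fin.append_left]
    rw [Function.update_of_ne, Fin.append_left]
    simp [Fin.ext_iff]
    omega
  · simp [Function.update_apply]

/-- Expanding the wedge product multilinearly in the slots `x_{β⁰} + x_{β¹}` gives the sum over `μ`.
-/
theorem pairForm_eq (i j : Fin 4) :
    T.pairForm k i j = exteriorPower.pairingDual k (Fin n → k) p (exteriorPower.ιMulti k p
      (T.covectors k (LinearMap.proj (T.α i)) (LinearMap.proj (T.α j)))) := by
  obtain ⟨m, c, rfl, α, β, γ⟩ := T
  let F : MultilinearMap k (fun _ : Fin m => (Fin n → k) →ₗ[k] k)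
      (⋀[k]^(2 + m + c) ((Fin n → k) →ₗ[k] k)) :=
    { toFun := fun h => exteriorPower.ιMulti k (2 + m + c) (Fin.append (Fin.append
          ![LinearMap.proj (α i), LinearMap.proj (α j)] h) fun l => LinearMap.proj (γ l))
      map_update_add' := by
        intro inst h l x y
        obtain rfl := Subsingleton.elim inst (instDecidableEqFin m)
        simp only [append_update_right, append_update_left, AlternatingMap.map_update_add]
      map_update_smul' := by
        intro inst h l x y
        obtain rfl := Subsingleton.elim inst (instDecidableEqFin m)
        simp only [append_update_right, append_update_left, AlternatingMap.map_update_smul] }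
  have h := F.map_sum (fun l ν => (LinearMap.proj (β l ν) : (Fin n → k) →ₗ[k] k))
  have h2 := congrArg (exteriorPower.pairingDual k (Fin n → k) (2 + m + c)) h
  rw [map_sum] at h2
  refine Eq.trans ?_ h2.symm
  rw [pairForm]
  refine Finset.sum_congr rfl fun μ _ => ?_
  refine congrArg (fun g => exteriorPower.pairingDual k (Fin n → k) (2 + m + c)
    (exteriorPower.ιMulti k (2 + m + c) g)) (funext fun l => ?_)
  simp only [indices, Function.comp_apply, Fin.cast_refl, id_eq]
  induction l using Fin.addCases with
  | right l => simp
  | left l =>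
    induction l using Fin.addCases with
    | right l => simp
    | left l => fin_cases l <;> simp

/-- The position of the first index. -/
def firstPos : Fin p := Fin.cast T.card_eq (Fin.castAdd T.c (Fin.castAdd T.m 0))

/-- The position of the second index. -/
def secondPos : Fin p := Fin.cast T.card_eq (Fin.castAdd T.c (Fin.castAdd T.m 1))

theorem firstPos_ne_secondPos : T.firstPos ≠ T.secondPos := by
  simp [firstPos, secondPos, Fin.ext_iff]

theorem covectors_eq_update (x y : (Fin n → k) →ₗ[k] k) :
    T.covectors k x y = Function.update (Function.update (T.covectors k 0 0) T.firstPos x)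
      T.secondPos y := by
  obtain ⟨m, c, rfl, α, β, γ⟩ := T
  simp only [covectors, firstPos, secondPos, Fin.cast_refl, Function.comp_id, id_eq]
  rw [← append_update_left, ← append_update_left, ← append_update_left, ← append_update_left]
  congr 2
  funext l
  fin_cases l <;> rfl

/-- On a decomposable element, `πᵢⱼ` is a determinant `D` in which only two rows depend on `i` and
`j`. The three-term relation for `D` makes this alternating array decomposable. -/
theorem exists_pairForm_ιMulti (v : Fin p → Fin n → k) : ∃ u w : Fin 4 → k,
    ∀ i j, T.pairForm k i j (exteriorPower.ιMulti k p v) = u i * w j - u j * w i := by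
  let g : Fin 4 → Fin p → k := fun i a => v a (T.α i)
  let r : Fin p → Fin p → k := fun b a => T.covectors k 0 0 b (v a)
  let D : (Fin p → k) → (Fin p → k) → k := fun x y =>
    (Matrix.of (Function.update (Function.update r T.firstPos x) T.secondPos y)).det
  have hD : ∀ i j, T.pairForm k i j (exteriorPower.ιMulti k p v) = D (g i) (g j) := by
    intro i j
    rw [pairForm_eq, exteriorPower.pairingDual_ιMulti_ιMulti, ← Matrix.det_transpose,
      covectors_eq_update]
    congr 1
    ext b a
    simp only [Matrix.transpose_apply, Matrix.of_apply, Function.update_apply]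
    split_ifs <;> rfl
  have h3 : ∀ x y x' y', D x y * D x' y' = D x' y * D x y' - D y' y * D x x' :=
    det_update_update_mul r T.firstPos_ne_secondPos
  by_cases h0 : ∀ i j, D (g i) (g j) = 0
  · exact ⟨0, 0, fun i j => by simp [hD, h0]⟩
  push Not at h0
  obtain ⟨i0, j0, h0⟩ := h0
  -- The same chart argument in `⋀² k⁴`, around the nonzero entry `(i0, j0)`.
  refine ⟨fun i => D (g i) (g j0) / D (g i0) (g j0), fun j => D (g i0) (g j), fun i j => ?_⟩
  rw [hD]
  have := h3 (g i0) (g j0) (g i) (g j)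
  field_simp
  linear_combination this

theorem preservesGrassmannCone : PreservesGrassmannCone (toPlane (T.pairForm k)) := by
  rintro ω ⟨v, rfl⟩
  obtain ⟨u, w, h⟩ := T.exists_pairForm_ιMulti v
  exact ⟨![u, w], toPlane_eq_ιMulti h⟩

theorem form_eq_comp : T.form k = (threeTermPlucker k).comp (toPlane (T.pairForm k)) :=
  (threeTermPlucker_comp_toPlane _).symm

theorem form_eq_zero_of_isDecomposable {ω : ⋀[k]^p (Fin n → k)} (h : IsDecomposable ω) :
    T.form k ω = 0 := by
  obtain ⟨v, hv⟩ := T.preservesGrassmannCone ω h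
  rw [form_eq_comp, QuadraticMap.comp_apply, hv, threeTermPlucker_ιMulti]

end IndexTriple

/-! ### Independence of the six forms, and finiteness -/

section Dual

variable {k : Type*} [Field k] {p n : ℕ}

theorem coordinate_ιMulti_single_self {w : Fin p → Fin n} (hw : Function.Injective w) :
    coordinate k w (exteriorPower.ιMulti k p fun a => Pi.single (w a) (1 : k)) = 1 := by
  rw [coordinate_ιMulti]
  convert Matrix.det_one (n := Fin p) (R := k)
  ext a b
  simp [Pi.single_apply, Matrix.one_apply, hw.eq_iff, eq_comm]

theorem coordinate_ιMulti_single_of_notMem {w u : Fin p → Fin n} {c : Fin p}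
    (hc : w c ∉ Set.range u) :
    coordinate k w (exteriorPower.ιMulti k p fun a => Pi.single (u a) (1 : k)) = 0 := by
  rw [coordinate_ιMulti]
  refine Matrix.det_eq_zero_of_column_eq_zero c fun a => ?_
  rw [Matrix.of_apply, Pi.single_apply, if_neg]
  rintro h
  exact hc ⟨a, h.symm⟩

end Dual

namespace IndexTriple

variable {k : Type*} [Field k] {p n : ℕ} (T : IndexTriple p n)

theorem mem_range_indices {i j : Fin 4} {μ : Fin T.m → Fin 2} {x : Fin n} :
    x ∈ Set.range (T.indices i j μ)
      ↔ x = T.α i ∨ x = T.α j ∨ (∃ l, x = T.β l (μ l)) ∨ ∃ l, x = T.γ l := by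
  obtain ⟨m, c, rfl, α, β, γ⟩ := T
  simp only [indices, Fin.cast_refl, Function.comp_id, Set.mem_range]
  constructor
  · rintro ⟨l, rfl⟩
    induction l using Fin.addCases with
    | right l => simp
    | left l =>
      induction l using Fin.addCases with
      | right l => exact Or.inr (Or.inr (Or.inl ⟨l, by simp⟩))
      | left l => fin_cases l <;> simp
  · rintro (rfl | rfl | ⟨l, rfl⟩ | ⟨l, rfl⟩)
    · exact ⟨Fin.castAdd c (Fin.castAdd m 0), by simp⟩
    · exact ⟨Fin.castAdd c (Fin.castAdd m 1), by simp⟩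
    · exact ⟨Fin.castAdd c (Fin.natAdd 2 l), by simp⟩
    · exact ⟨Fin.natAdd (2 + m) l, by simp⟩

/-- All the indices of `T`, as one family. -/
def allIndices : Fin 4 ⊕ (Fin T.m × Fin 2) ⊕ Fin T.c → Fin n :=
  Sum.elim T.α (Sum.elim (fun q : Fin T.m × Fin 2 => T.β q.1 q.2) T.γ)

variable {T}

theorem indices_injective (hT : Function.Injective T.allIndices) {i j : Fin 4}
    (hij : i ≠ j) (μ : Fin T.m → Fin 2) : Function.Injective (T.indices i j μ) := by
  obtain ⟨m, c, rfl, α, β, γ⟩ := T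
  have h : indices ⟨m, c, rfl, α, β, γ⟩ i j μ = allIndices ⟨m, c, rfl, α, β, γ⟩ ∘
      Fin.append (Fin.append ![Sum.inl i, Sum.inl j] fun l => Sum.inr (Sum.inl (l, μ l)))
        (fun l => Sum.inr (Sum.inr l)) := by
    simp only [indices, Fin.cast_refl, Function.comp_id]
    funext l
    induction l using Fin.addCases with
    | right l => simp [allIndices]
    | left l =>
      induction l using Fin.addCases with
      | right l => simp [allIndices]
      | left l => fin_cases l <;> simp [allIndices]
  rw [h]
  refine hT.comp ?_
  rw [Fin.append_injective_iff, Fin.append_injective_iff]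
  refine ⟨⟨?_, ?_, ?_⟩, ?_, ?_⟩
  · intro a b
    fin_cases a <;> fin_cases b <;> simp [hij, hij.symm]
  · intro a b
    simp +contextual
  · intro a b
    fin_cases a <;> simp
  · intro a b
    simp
  · intro a b
    induction a using Fin.addCases with
    | right l => simp
    | left l => fin_cases l <;> simp

/-- Distinctness of the indices means that a basis vector built from the choice `μ = 0` meets just
one summand of one `πᵢⱼ`. These vectors are the dual family used for the rank. -/
theorem pairForm_ιMulti_single (hT : Function.Injective T.allIndices) {i j i' j' : Fin 4}
    (hij : i < j) (hij' : i' < j') :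
    T.pairForm k i j (exteriorPower.ιMulti k p fun a => Pi.single (T.indices i' j' 0 a) (1 : k))
      = if (i, j) = (i', j') then 1 else 0 := by
  have hα : ∀ a, T.α a ∈ Set.range (T.indices i' j' 0) → a = i' ∨ a = j' := by
    intro a h
    rw [mem_range_indices] at h
    rcases h with h | h | ⟨l, h⟩ | ⟨l, h⟩
    · exact Or.inl (Sum.inl_injective (hT (a₁ := Sum.inl a) (a₂ := Sum.inl i') h))
    · exact Or.inr (Sum.inl_injective (hT (a₁ := Sum.inl a) (a₂ := Sum.inl j') h))
    · have := hT (a₁ := Sum.inl a) (a₂ := Sum.inr (Sum.inl (l, 0))) h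
      simp at this
    · have := hT (a₁ := Sum.inl a) (a₂ := Sum.inr (Sum.inr l)) h
      simp at this
  have hβ : ∀ a ν, T.β a ν ∈ Set.range (T.indices i' j' 0) → ν = 0 := by
    intro a ν h
    rw [mem_range_indices] at h
    rcases h with h | h | ⟨l, h⟩ | ⟨l, h⟩
    · have := hT (a₁ := Sum.inr (Sum.inl (a, ν))) (a₂ := Sum.inl i') h
      simp at this
    · have := hT (a₁ := Sum.inr (Sum.inl (a, ν))) (a₂ := Sum.inl j') h
      simp at this
    · have := hT (a₁ := Sum.inr (Sum.inl (a, ν))) (a₂ := Sum.inr (Sum.inl (l, 0))) h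
      simp at this
      exact this.2
    · have := hT (a₁ := Sum.inr (Sum.inl (a, ν))) (a₂ := Sum.inr (Sum.inr l)) h
      simp at this
  rw [pairForm, LinearMap.sum_apply]
  have hzero : ∀ μ, (∃ x ∈ Set.range (T.indices i j μ), x ∉ Set.range (T.indices i' j' 0)) →
      coordinate k (T.indices i j μ) (exteriorPower.ιMulti k p
        fun a => Pi.single (T.indices i' j' 0 a) (1 : k)) = 0 := by
    rintro μ ⟨x, ⟨c, rfl⟩, hx⟩
    exact coordinate_ιMulti_single_of_notMem hx
  split_ifs with h
  · obtain ⟨rfl, rfl⟩ := Prod.mk.inj h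
    rw [Finset.sum_eq_single_of_mem 0 (Finset.mem_univ _)]
    · exact coordinate_ιMulti_single_self (indices_injective hT hij.ne 0)
    · intro μ _ hμ
      obtain ⟨l, hl⟩ := Function.ne_iff.mp hμ
      refine hzero μ ⟨T.β l (μ l), ?_, fun hx => hl (hβ _ _ hx)⟩
      rw [mem_range_indices]
      exact Or.inr (Or.inr (Or.inl ⟨l, rfl⟩))
  · refine Finset.sum_eq_zero fun μ _ => hzero μ ?_
    by_contra! hc
    have h1 := hα i (hc _ (T.mem_range_indices.mpr (Or.inl rfl)))
    have h2 := hα j (hc _ (T.mem_range_indices.mpr (Or.inr (Or.inl rfl))))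
    refine h (Prod.ext ?_ ?_)
    · show i = i'
      omega
    · show j = j'
      omega

theorem formRank_form (hT : Function.Injective T.allIndices) : formRank (T.form k) = 6 := by
  let P : Fin 6 → Fin 4 × Fin 4 := ![(0, 1), (2, 3), (0, 2), (1, 3), (0, 3), (1, 2)]
  have hP : ∀ q, (P q).1 < (P q).2 := by decide
  have hPi : Function.Injective P := by decide
  have hx : ∀ q, threeTermForms (T.pairForm k) q = T.pairForm k (P q).1 (P q).2 := by
    intro q
    fin_cases q <;> rfl
  refine formRank_threeTerm _ (fun q => exteriorPower.ιMulti k p fun a =>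
    Pi.single (T.indices (P q).1 (P q).2 0 a) (1 : k)) fun q r => ?_
  rw [hx, pairForm_ιMulti_single hT (hP q) (hP r)]
  simp only [Prod.mk.eta, hPi.eq_iff]

end IndexTriple

theorem finite_indexTriple (p n : ℕ) : Finite (IndexTriple p n) := by
  let X := Σ m : Fin (p + 1), Σ c : Fin (p + 1),
    (Fin 4 → Fin n) × (Fin m → Fin 2 → Fin n) × (Fin c → Fin n)
  let F : IndexTriple p n → X := fun T =>
    ⟨⟨T.m, by have := T.card_eq; omega⟩, ⟨T.c, by have := T.card_eq; omega⟩, T.α, T.β, T.γ⟩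
  refine Finite.of_injective F ?_
  rintro ⟨m, c, h, α, β, γ⟩ ⟨m', c', h', α', β', γ'⟩ hF
  obtain rfl : m = m' := congrArg (fun x : X => (x.1 : ℕ)) hF
  obtain rfl : c = c' := congrArg (fun x : X => (x.2.1 : ℕ)) hF
  simp [F] at hF
  obtain ⟨rfl, rfl, rfl⟩ := hF
  rfl

theorem finite_rankSixForms (k : Type*) [Field k] (p n : ℕ) : (rankSixForms k p n).Finite := by
  have := finite_indexTriple p n
  refine (Set.finite_range fun T : IndexTriple p n => T.form k).subset ?_
  rintro Q ⟨T, -, rfl⟩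
  exact ⟨T, rfl⟩

/-! ### Reordering the indices `αᵢ` -/

section Sorting

/-- The three-term expression only changes sign when its indices are permuted. -/
theorem threeTerm_eq_zero_of_perm {k : Type*} [Field k] (σ : Equiv.Perm (Fin 4)) :
    ∀ x : Fin 4 → Fin 4 → k, (∀ i j, x j i = -x i j) →
      x (σ 0) (σ 1) * x (σ 2) (σ 3) - x (σ 0) (σ 2) * x (σ 1) (σ 3)
        + x (σ 0) (σ 3) * x (σ 1) (σ 2) = 0 →
      x 0 1 * x 2 3 - x 0 2 * x 1 3 + x 0 3 * x 1 2 = 0 := by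
  induction σ using Equiv.Perm.swap_induction_on with
  | one => exact fun x _ h => h
  | swap_mul f a b hab ih =>
    intro x hx h
    have h1 := ih (fun i j => x (Equiv.swap a b i) (Equiv.swap a b j)) (fun i j => hx _ _) h
    have h10 := hx 0 1
    have h20 := hx 0 2
    have h30 := hx 0 3
    have h21 := hx 1 2
    have h31 := hx 1 3
    have h32 := hx 2 3
    clear h ih hx
    -- Each transposition negates the expression, once antisymmetry has brought all pairs into
    -- increasing order.
    fin_cases a <;> fin_cases b <;>
      first
      | exact absurd rfl hab
      | (simp [Equiv.swap_apply_def] at h1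
         simp only [h10, h20, h30, h21, h31, h32] at h1
         linear_combination -h1)

end Sorting

namespace IndexTriple

variable {k : Type*} [Field k] {p n : ℕ} (T : IndexTriple p n)

theorem pairForm_swap (i j : Fin 4) : T.pairForm k j i = -T.pairForm k i j := by
  have h := (exteriorPower.ιMulti k p (M := (Fin n → k) →ₗ[k] k)).map_swap
    (T.covectors k (LinearMap.proj (T.α i)) (LinearMap.proj (T.α j))) T.firstPos_ne_secondPos
  rw [pairForm_eq, pairForm_eq, ← map_neg]
  refine congrArg _ (Eq.trans (congrArg _ ?_) h)
  have hne := T.firstPos_ne_secondPos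
  rw [covectors_eq_update, covectors_eq_update T (LinearMap.proj (T.α i))]
  funext c
  rcases eq_or_ne c T.firstPos with rfl | h1
  · simp [hne]
  rcases eq_or_ne c T.secondPos with rfl | h2
  · simp [hne]
  · simp [Equiv.swap_apply_of_ne_of_ne h1 h2, h1, h2]

theorem form_apply (ω : ⋀[k]^p (Fin n → k)) : T.form k ω
    = T.pairForm k 0 1 ω * T.pairForm k 2 3 ω - T.pairForm k 0 2 ω * T.pairForm k 1 3 ω
      + T.pairForm k 0 3 ω * T.pairForm k 1 2 ω := rfl

/-- The index data with the `αᵢ` listed in another order. -/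
def permute (σ : Equiv.Perm (Fin 4)) : IndexTriple p n := { T with α := T.α ∘ σ }

theorem allIndices_permute_injective (h : Function.Injective T.allIndices)
    (σ : Equiv.Perm (Fin 4)) : Function.Injective (T.permute σ).allIndices := by
  obtain ⟨m, c, hc, α, β, γ⟩ := T
  have := h.comp (Sum.map_injective.mpr ⟨σ.injective, Function.injective_id⟩)
  have e : (permute ⟨m, c, hc, α, β, γ⟩ σ).allIndices
      = allIndices ⟨m, c, hc, α, β, γ⟩ ∘ Sum.map σ id := by
    funext i
    rcases i with i | i <;> rfl
  rwa [e]

theorem form_eq_zero_of_permute {ω : ⋀[k]^p (Fin n → k)} {σ : Equiv.Perm (Fin 4)}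
    (h : (T.permute σ).form k ω = 0) : T.form k ω = 0 :=
  threeTerm_eq_zero_of_perm σ (fun i j => T.pairForm k i j ω)
    (fun i j => by rw [pairForm_swap, LinearMap.neg_apply]) h

end IndexTriple

/-- Index data attached to two sequences `s`, `t`: increasing enumerations `A` of the entries of
`s` only, `B` of the entries of `t` only, and `γ` of the common entries. -/
structure Splitting {p n : ℕ} (s t : Fin p → Fin n) (m : ℕ) where
  c : ℕ
  card_eq : 2 + m + c = p
  A : Fin (m + 2) → Fin n
  B : Fin (m + 2) → Fin n
  γ : Fin c → Fin n
  A_strictMono : StrictMono A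
  B_strictMono : StrictMono B
  γ_strictMono : StrictMono γ
  A_ne_B : ∀ i j, A i ≠ B j
  A_ne_γ : ∀ i j, A i ≠ γ j
  B_ne_γ : ∀ i j, B i ≠ γ j
  range_left : Set.range s = Set.range A ∪ Set.range γ
  range_right : Set.range t = Set.range B ∪ Set.range γ

theorem exists_splitting {p n m : ℕ} {s t : Fin p → Fin n} (hs : Function.Injective s)
    (ht : Function.Injective t) (h : indexDist s t = m + 2) : Nonempty (Splitting s t m) := by
  classical
  let S := Finset.univ.image s
  let T := Finset.univ.image t
  have hS : S.card = p := by rw [Finset.card_image_of_injective _ hs, Finset.card_fin]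
  have hT : T.card = p := by rw [Finset.card_image_of_injective _ ht, Finset.card_fin]
  have hTS : (T \ S).card = m + 2 := by
    rw [← h, indexDist, ← Set.ncard_image_of_injective _ ht, ← Set.ncard_coe_finset]
    congr 1
    ext x
    simp only [S, T, Finset.coe_sdiff, Finset.coe_image, Finset.coe_univ, Set.image_univ,
      Set.mem_sdiff, Set.mem_image, Set.mem_ofPred_eq]
    constructor
    · rintro ⟨⟨b, rfl⟩, hb⟩
      exact ⟨b, hb, rfl⟩
    · rintro ⟨b, hb, rfl⟩
      exact ⟨⟨b, rfl⟩, hb⟩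
  have hST : (S \ T).card = m + 2 := by rw [← hTS, Finset.card_sdiff_comm (hS.trans hT.symm)]
  have hI := Finset.card_inter_add_card_sdiff S T
  have hmem : ∀ {j : ℕ} {U : Finset (Fin n)} (hU : U.card = j) (i : Fin j),
      U.orderEmbOfFin hU i ∈ U := fun hU i => Finset.orderEmbOfFin_mem _ hU i
  refine ⟨⟨(S ∩ T).card, by omega, (S \ T).orderEmbOfFin hST, (T \ S).orderEmbOfFin hTS,
    (S ∩ T).orderEmbOfFin rfl, OrderEmbedding.strictMono _, OrderEmbedding.strictMono _,
    OrderEmbedding.strictMono _, fun i j hij => ?_, fun i j hij => ?_, fun i j hij => ?_, ?_, ?_⟩⟩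
  · have h1 := hmem hST i
    have h2 := hmem hTS j
    rw [← hij] at h2
    simp only [Finset.mem_sdiff] at h1 h2
    exact h2.2 h1.1
  · have h1 := hmem hST i
    have h2 := hmem (U := S ∩ T) rfl j
    rw [← hij] at h2
    simp only [Finset.mem_sdiff, Finset.mem_inter] at h1 h2
    exact h1.2 h2.2
  · have h1 := hmem hTS i
    have h2 := hmem (U := S ∩ T) rfl j
    rw [← hij] at h2
    simp only [Finset.mem_sdiff, Finset.mem_inter] at h1 h2
    exact h1.2 h2.1
  · rw [Finset.range_orderEmbOfFin, Finset.range_orderEmbOfFin, ← Finset.coe_union,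
      Finset.sdiff_union_inter]
    simp [S]
  · rw [Finset.range_orderEmbOfFin, Finset.range_orderEmbOfFin, ← Finset.coe_union,
      Finset.inter_comm, Finset.sdiff_union_inter]
    simp [T]

/-! ### Ordered index data separating two sequences -/

namespace Splitting

variable {k : Type*} [Field k] {p n m : ℕ} {s t : Fin p → Fin n} (D : Splitting s t m)

/-- The index data that separates `s` from `t`: the `l`-th entries of `A` and `B` form the pair
`β_l`, and the last two entries of `A` and `B` are the `αᵢ`. -/
def triple : IndexTriple p n where
  m := m
  c := D.c
  card_eq := D.card_eq
  α := ![D.A (Fin.natAdd m 0), D.A (Fin.natAdd m 1), D.B (Fin.natAdd m 0), D.B (Fin.natAdd m 1)]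
  β l := ![min (D.A (Fin.castAdd 2 l)) (D.B (Fin.castAdd 2 l)),
    max (D.A (Fin.castAdd 2 l)) (D.B (Fin.castAdd 2 l))]
  γ := D.γ

theorem β_cases (l : Fin m) :
    (D.triple.β l 0 = D.A (Fin.castAdd 2 l) ∧ D.triple.β l 1 = D.B (Fin.castAdd 2 l)) ∨
    (D.triple.β l 0 = D.B (Fin.castAdd 2 l) ∧ D.triple.β l 1 = D.A (Fin.castAdd 2 l)) := by
  rcases le_total (D.A (Fin.castAdd 2 l)) (D.B (Fin.castAdd 2 l)) with h | h
  · left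
    simp [triple, h]
  · right
    simp [triple, h]

theorem β_cases' (l : Fin m) (ν : Fin 2) : D.triple.β l ν = D.A (Fin.castAdd 2 l)
    ∨ D.triple.β l ν = D.B (Fin.castAdd 2 l) := by
  rcases D.β_cases l with h | h <;> fin_cases ν <;> simp [h]

theorem α_cases (i : Fin 4) : ∃ q : Fin 2, D.triple.α i = D.A (Fin.natAdd m q)
    ∨ D.triple.α i = D.B (Fin.natAdd m q) := by
  fin_cases i
  · exact ⟨0, Or.inl rfl⟩
  · exact ⟨1, Or.inl rfl⟩
  · exact ⟨0, Or.inr rfl⟩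
  · exact ⟨1, Or.inr rfl⟩

theorem castAdd_ne_natAdd {a b : ℕ} (i : Fin a) (j : Fin b) : Fin.castAdd b i ≠ Fin.natAdd a j := by
  simp [Fin.ext_iff]
  omega

theorem allIndices_injective : Function.Injective D.triple.allIndices := by
  have hA := D.A_strictMono.injective
  have hB := D.B_strictMono.injective
  have hAB := D.A_ne_B
  have hBA := fun i j => (D.A_ne_B j i).symm
  refine Function.Injective.sumElim ?_ (Function.Injective.sumElim ?_ D.γ_strictMono.injective ?_) ?_
  · intro i j hij
    fin_cases i <;> fin_cases j <;> simp [triple, hAB, hBA, hA.eq_iff, hB.eq_iff] at hij ⊢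
  · rintro ⟨l, ν⟩ ⟨l', ν'⟩ h
    simp only at h
    have hl : l = l' := by
      rcases D.β_cases' l ν with h1 | h1 <;> rcases D.β_cases' l' ν' with h2 | h2 <;>
        rw [h1, h2] at h
      · exact Fin.castAdd_injective _ _ (hA h)
      · exact absurd h (hAB _ _)
      · exact absurd h (hBA _ _)
      · exact Fin.castAdd_injective _ _ (hB h)
    subst hl
    congr 1
    rcases D.β_cases l with h1 | h1 <;> fin_cases ν <;> fin_cases ν' <;>
      simp [h1, hAB, hBA] at h ⊢
  · rintro ⟨l, ν⟩ j h
    rcases D.β_cases' l ν with h1 | h1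
    · exact D.A_ne_γ _ j (h1.symm.trans h)
    · exact D.B_ne_γ _ j (h1.symm.trans h)
  · rintro i (⟨l, ν⟩ | j) h
    · obtain ⟨q, h1⟩ := D.α_cases i
      change D.triple.α i = D.triple.β l ν at h
      rcases h1 with h1 | h1 <;> rcases D.β_cases' l ν with h2 | h2 <;> rw [h1, h2] at h
      · exact castAdd_ne_natAdd _ _ (hA h).symm
      · exact absurd h (hAB _ _)
      · exact absurd h (hBA _ _)
      · exact castAdd_ne_natAdd _ _ (hB h).symm
    · obtain ⟨q, h1⟩ := D.α_cases i
      rcases h1 with h1 | h1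
      · exact D.A_ne_γ _ j (h1.symm.trans h)
      · exact D.B_ne_γ _ j (h1.symm.trans h)

/-- Sorting the `αᵢ` suffices. Entrywise minima and maxima of increasing sequences increase, and
each `αᵢ` exceeds all paired entries of the sequence, `A` or `B`, that it comes from. -/
theorem exists_isOrdered_permute : ∃ σ, (D.triple.permute σ).IsOrdered := by
  have hinj := D.allIndices_injective
  have hα : Function.Injective D.triple.α := hinj.comp Sum.inl_injective
  have hσ : StrictMono (D.triple.α ∘ Tuple.sort D.triple.α) :=
    (Tuple.monotone_sort _).strictMono_of_injective (hα.comp (Equiv.injective _))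
  have hA : ∀ l q, D.A (Fin.castAdd 2 l) < D.A (Fin.natAdd m q) := fun l q =>
    D.A_strictMono (by simp [Fin.lt_def]; omega)
  have hB : ∀ l q, D.B (Fin.castAdd 2 l) < D.B (Fin.natAdd m q) := fun l q =>
    D.B_strictMono (by simp [Fin.lt_def]; omega)
  have hcast : ∀ {l l' : Fin m}, l < l' → Fin.castAdd 2 l < Fin.castAdd 2 l' := fun h => h
  refine ⟨Tuple.sort D.triple.α, ⟨?_, hσ, fun l => ?_, fun ν l l' hl => ?_,
    fun (l : Fin m) => ?_, fun (l : Fin m) => ?_, D.γ_strictMono⟩⟩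
  · exact D.triple.allIndices_permute_injective hinj _
  · show min _ _ < max _ _
    exact min_lt_max.mpr (D.A_ne_B _ _)
  · have h1 := D.A_strictMono (hcast hl)
    have h2 := D.B_strictMono (hcast hl)
    fin_cases ν
    · exact min_lt_min h1 h2
    · exact max_lt_max h1 h2
  · show min _ _ < D.triple.α (Tuple.sort D.triple.α 0)
    obtain ⟨q, h | h⟩ := D.α_cases (Tuple.sort D.triple.α 0)
    · rw [h]
      exact min_lt_of_left_lt (hA _ _)
    · rw [h]
      exact min_lt_of_right_lt (hB _ _)
  · show max _ _ < D.triple.α (Tuple.sort D.triple.α 2)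
    set σ := Tuple.sort D.triple.α with hσd
    have h01 : σ 0 ≠ σ 1 := fun h => by simp at h
    have h02 : σ 0 ≠ σ 2 := fun h => by simp at h
    have h12 : σ 1 ≠ σ 2 := fun h => by simp at h
    have h0 : D.triple.α (σ 0) < D.triple.α (σ 2) := hσ (by decide)
    have h1 : D.triple.α (σ 1) < D.triple.α (σ 2) := hσ (by decide)
    refine max_lt ?_ ?_
    · have key : ∀ i : Fin 4, D.triple.α i ≤ D.A (Fin.castAdd 2 l) → i = 2 ∨ i = 3 := by
        intro i hi
        fin_cases i
        · exact absurd hi (not_le.mpr (hA l 0))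
        · exact absurd hi (not_le.mpr (hA l 1))
        · simp
        · simp
      by_contra! hc
      have := key _ hc
      have := key _ (h0.le.trans hc)
      have := key _ (h1.le.trans hc)
      omega
    · have key : ∀ i : Fin 4, D.triple.α i ≤ D.B (Fin.castAdd 2 l) → i = 0 ∨ i = 1 := by
        intro i hi
        fin_cases i
        · simp
        · simp
        · exact absurd hi (not_le.mpr (hB l 0))
        · exact absurd hi (not_le.mpr (hB l 1))
      by_contra! hc
      have := key _ hc
      have := key _ (h0.le.trans hc)
      have := key _ (h1.le.trans hc)
      omega

theorem form_triple_eq_zero {ω : ⋀[k]^p (Fin n → k)} (h : ∀ Q ∈ rankSixForms k p n, Q ω = 0) :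
    D.triple.form k ω = 0 := by
  obtain ⟨σ, hσ⟩ := D.exists_isOrdered_permute
  exact D.triple.form_eq_zero_of_permute (h _ ⟨_, hσ, rfl⟩)

end Splitting

/-! ### Isolating the product `Π_s Π_t` -/

namespace Splitting

variable {k : Type*} [Field k] {p n m : ℕ} {s t : Fin p → Fin n} (D : Splitting s t m)

theorem mem_left {x : Fin n} : x ∈ Set.range s ↔ (∃ l, x = D.A l) ∨ ∃ l, x = D.γ l := by
  rw [D.range_left]
  simp [eq_comm]

theorem mem_right {x : Fin n} : x ∈ Set.range t ↔ (∃ l, x = D.B l) ∨ ∃ l, x = D.γ l := by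
  rw [D.range_right]
  simp [eq_comm]

theorem A_mem (l : Fin (m + 2)) : D.A l ∈ Set.range s := D.mem_left.mpr (Or.inl ⟨l, rfl⟩)

theorem B_mem (l : Fin (m + 2)) : D.B l ∈ Set.range t := D.mem_right.mpr (Or.inl ⟨l, rfl⟩)

theorem A_notMem (l : Fin (m + 2)) : D.A l ∉ Set.range t := by
  rw [D.mem_right]
  rintro (⟨j, h⟩ | ⟨j, h⟩)
  · exact D.A_ne_B _ _ h
  · exact D.A_ne_γ _ _ h

theorem B_notMem (l : Fin (m + 2)) : D.B l ∉ Set.range s := by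
  rw [D.mem_left]
  rintro (⟨j, h⟩ | ⟨j, h⟩)
  · exact D.A_ne_B _ _ h.symm
  · exact D.B_ne_γ _ _ h

theorem indices_mem (i j : Fin 4) (μ : Fin D.triple.m → Fin 2) (c : Fin p) :
    D.triple.indices i j μ c ∈ Set.range s ∨ D.triple.indices i j μ c ∈ Set.range t := by
  have h := D.triple.mem_range_indices.mp (Set.mem_range_self (f := D.triple.indices i j μ) c)
  rw [D.mem_left, D.mem_right]
  have hα : ∀ i, (∃ l, D.triple.α i = D.A l) ∨ ∃ l, D.triple.α i = D.B l := fun i => by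
    obtain ⟨q, h | h⟩ := D.α_cases i
    · exact Or.inl ⟨_, h⟩
    · exact Or.inr ⟨_, h⟩
  rcases h with h | h | ⟨l, h⟩ | ⟨l, h⟩
  · rw [h]
    exact (hα i).imp Or.inl Or.inl
  · rw [h]
    exact (hα j).imp Or.inl Or.inl
  · rw [h]
    exact (D.β_cases' l (μ l)).imp (fun h => Or.inl ⟨_, h⟩) (fun h => Or.inl ⟨_, h⟩)
  · exact Or.inl (Or.inr ⟨l, h⟩)

/-- The choices `μ` picking the entries of `s`. -/
theorem exists_choice_left : ∃ μ : Fin D.triple.m → Fin 2, (∀ l, D.triple.β l (μ l) = D.A (Fin.castAdd 2 l))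
    ∧ ∀ μ', μ' ≠ μ → ∃ l, D.triple.β l (μ' l) = D.B (Fin.castAdd 2 l) := by
  have h : ∀ l, ∃ ν, D.triple.β l ν = D.A (Fin.castAdd 2 l) ∧
      ∀ ν', ν' ≠ ν → D.triple.β l ν' = D.B (Fin.castAdd 2 l) := by
    intro l
    rcases D.β_cases l with h | h
    · exact ⟨0, h.1, fun ν' hν' => by fin_cases ν' <;> simp_all⟩
    · exact ⟨1, h.2, fun ν' hν' => by fin_cases ν' <;> simp_all⟩
  choose μ h1 h2 using h
  refine ⟨μ, h1, fun μ' hμ' => ?_⟩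
  obtain ⟨l, hl⟩ := Function.ne_iff.mp hμ'
  exact ⟨l, h2 l _ hl⟩

theorem exists_choice_right : ∃ μ : Fin D.triple.m → Fin 2,
    (∀ l, D.triple.β l (μ l) = D.B (Fin.castAdd 2 l))
    ∧ ∀ μ', μ' ≠ μ → ∃ l, D.triple.β l (μ' l) = D.A (Fin.castAdd 2 l) := by
  have h : ∀ l, ∃ ν, D.triple.β l ν = D.B (Fin.castAdd 2 l) ∧
      ∀ ν', ν' ≠ ν → D.triple.β l ν' = D.A (Fin.castAdd 2 l) := by
    intro l
    rcases D.β_cases l with h | h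
    · exact ⟨1, h.2, fun ν' hν' => by fin_cases ν' <;> simp_all⟩
    · exact ⟨0, h.1, fun ν' hν' => by fin_cases ν' <;> simp_all⟩
  choose μ h1 h2 using h
  refine ⟨μ, h1, fun μ' hμ' => ?_⟩
  obtain ⟨l, hl⟩ := Function.ne_iff.mp hμ'
  exact ⟨l, h2 l _ hl⟩

theorem A_notMem_indices {i j : Fin 4} {μ : Fin D.triple.m → Fin 2} (q : Fin (m + 2))
    (hi : D.triple.α i ≠ D.A q) (hj : D.triple.α j ≠ D.A q)
    (hμ : ∀ l, D.triple.β l (μ l) ≠ D.A q) : D.A q ∉ Set.range (D.triple.indices i j μ) := by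
  rw [D.triple.mem_range_indices]
  rintro (h | h | ⟨l, h⟩ | ⟨l, h⟩)
  · exact hi h.symm
  · exact hj h.symm
  · exact hμ l h.symm
  · exact D.A_ne_γ _ _ h

theorem B_notMem_indices {i j : Fin 4} {μ : Fin D.triple.m → Fin 2} (q : Fin (m + 2))
    (hi : D.triple.α i ≠ D.B q) (hj : D.triple.α j ≠ D.B q)
    (hμ : ∀ l, D.triple.β l (μ l) ≠ D.B q) : D.B q ∉ Set.range (D.triple.indices i j μ) := by
  rw [D.triple.mem_range_indices]
  rintro (h | h | ⟨l, h⟩ | ⟨l, h⟩)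
  · exact hi h.symm
  · exact hj h.symm
  · exact hμ l h.symm
  · exact D.B_ne_γ _ _ h

theorem β_ne_A_last (l : Fin m) (ν q : Fin 2) : D.triple.β l ν ≠ D.A (Fin.natAdd m q) := by
  intro h
  rcases D.β_cases' l ν with h1 | h1 <;> rw [h1] at h
  · exact castAdd_ne_natAdd _ _ (D.A_strictMono.injective h)
  · exact D.A_ne_B _ _ h.symm

theorem β_ne_B_last (l : Fin m) (ν q : Fin 2) : D.triple.β l ν ≠ D.B (Fin.natAdd m q) := by
  intro h
  rcases D.β_cases' l ν with h1 | h1 <;> rw [h1] at h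
  · exact D.A_ne_B _ _ h
  · exact castAdd_ne_natAdd _ _ (D.B_strictMono.injective h)

theorem β_ne_A {l l' : Fin m} {ν : Fin 2} (h : D.triple.β l ν = D.B (Fin.castAdd 2 l))
    {μ : Fin D.triple.m → Fin 2} (hμ : μ l = ν) : D.triple.β l' (μ l') ≠ D.A (Fin.castAdd 2 l) := by
  intro h'
  rcases D.β_cases' l' (μ l') with h1 | h1
  · have : l' = l := Fin.castAdd_injective _ _ (D.A_strictMono.injective (h1.symm.trans h'))
    subst this
    rw [hμ] at h'
    exact D.A_ne_B _ _ (h'.symm.trans h)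
  · exact D.A_ne_B _ _ (h'.symm.trans h1)

theorem β_ne_B {l l' : Fin m} {ν : Fin 2} (h : D.triple.β l ν = D.A (Fin.castAdd 2 l))
    {μ : Fin D.triple.m → Fin 2} (hμ : μ l = ν) : D.triple.β l' (μ l') ≠ D.B (Fin.castAdd 2 l) := by
  intro h'
  rcases D.β_cases' l' (μ l') with h1 | h1
  · exact D.A_ne_B _ _ (h1.symm.trans h')
  · have : l' = l := Fin.castAdd_injective _ _ (D.B_strictMono.injective (h1.symm.trans h'))
    subst this
    rw [hμ] at h'
    exact D.A_ne_B _ _ (h.symm.trans h')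

theorem α_values : D.triple.α 0 = D.A (Fin.natAdd m 0) ∧ D.triple.α 1 = D.A (Fin.natAdd m 1)
    ∧ D.triple.α 2 = D.B (Fin.natAdd m 0) ∧ D.triple.α 3 = D.B (Fin.natAdd m 1) :=
  ⟨rfl, rfl, rfl, rfl⟩

theorem indices_mem_left {μ : Fin D.triple.m → Fin 2}
    (hμ : ∀ l, D.triple.β l (μ l) = D.A (Fin.castAdd 2 l)) (c : Fin p) :
    D.triple.indices 0 1 μ c ∈ Set.range s := by
  rw [D.mem_left]
  rcases D.triple.mem_range_indices.mp ⟨c, rfl⟩ with h | h | ⟨l, h⟩ | ⟨l, h⟩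
  · exact Or.inl ⟨_, h⟩
  · exact Or.inl ⟨_, h⟩
  · exact Or.inl ⟨_, h.trans (hμ l)⟩
  · exact Or.inr ⟨l, h⟩

theorem indices_mem_right {μ : Fin D.triple.m → Fin 2}
    (hμ : ∀ l, D.triple.β l (μ l) = D.B (Fin.castAdd 2 l)) (c : Fin p) :
    D.triple.indices 2 3 μ c ∈ Set.range t := by
  rw [D.mem_right]
  rcases D.triple.mem_range_indices.mp ⟨c, rfl⟩ with h | h | ⟨l, h⟩ | ⟨l, h⟩
  · exact Or.inl ⟨_, h⟩
  · exact Or.inl ⟨_, h⟩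
  · exact Or.inl ⟨_, h.trans (hμ l)⟩
  · exact Or.inr ⟨l, h⟩

/-- In the form separating `s` from `t`, `π₁₂` contains `± Π_s` and `π₃₄` contains `± Π_t`. Every
other summand of these, and every summand of `π₁₃` and `π₁₄`, omits an entry peculiar to `s` and one
peculiar to `t`, so it vanishes by hypothesis. -/
theorem coordinate_mul_eq_zero (D : Splitting s t m) {ω : ⋀[k]^p (Fin n → k)}
    (hω : ∀ Q ∈ rankSixForms k p n, Q ω = 0)
    (h : ∀ w : Fin p → Fin n, (∀ c, w c ∈ Set.range s ∨ w c ∈ Set.range t) →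
      (∃ x ∈ Set.range s, x ∉ Set.range t ∧ x ∉ Set.range w) →
      (∃ x ∈ Set.range t, x ∉ Set.range s ∧ x ∉ Set.range w) → coordinate k w ω = 0) :
    coordinate k s ω * coordinate k t ω = 0 := by
  have hA := D.A_strictMono.injective
  have hB := D.B_strictMono.injective
  have hAB := D.A_ne_B
  have hBA := fun i j => (D.A_ne_B j i).symm
  obtain ⟨α0, α1, α2, α3⟩ := D.α_values
  have hz : ∀ i j μ (a b : Fin (m + 2)), D.A a ∉ Set.range (D.triple.indices i j μ) →
      D.B b ∉ Set.range (D.triple.indices i j μ) → coordinate k (D.triple.indices i j μ) ω = 0 :=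
    fun i j μ a b ha hb => h _ (D.indices_mem i j μ) ⟨_, D.A_mem a, D.A_notMem a, ha⟩
      ⟨_, D.B_mem b, D.B_notMem b, hb⟩
  have h02 : D.triple.pairForm k 0 2 ω = 0 := by
    rw [IndexTriple.pairForm, LinearMap.sum_apply]
    refine Finset.sum_eq_zero fun μ _ => hz 0 2 μ (Fin.natAdd m 1) (Fin.natAdd m 1)
      (D.A_notMem_indices _ ?_ ?_ fun l => D.β_ne_A_last _ _ _)
      (D.B_notMem_indices _ ?_ ?_ fun l => D.β_ne_B_last _ _ _) <;>
    simp [α0, α2, hAB, hBA, hA.eq_iff, hB.eq_iff, Fin.ext_iff]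
  have h03 : D.triple.pairForm k 0 3 ω = 0 := by
    rw [IndexTriple.pairForm, LinearMap.sum_apply]
    refine Finset.sum_eq_zero fun μ _ => hz 0 3 μ (Fin.natAdd m 1) (Fin.natAdd m 0)
      (D.A_notMem_indices _ ?_ ?_ fun l => D.β_ne_A_last _ _ _)
      (D.B_notMem_indices _ ?_ ?_ fun l => D.β_ne_B_last _ _ _) <;>
    simp [α0, α3, hAB, hBA, hA.eq_iff, hB.eq_iff, Fin.ext_iff]
  have h01 : ∃ ε : k, ε * ε = 1 ∧ D.triple.pairForm k 0 1 ω = ε * coordinate k s ω := by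
    obtain ⟨μ, hμ, hμ'⟩ := D.exists_choice_left
    obtain ⟨ε, hε, he⟩ := exists_sign_of_forall_mem_range (k := k)
      (IndexTriple.indices_injective D.allIndices_injective (by decide) μ) (D.indices_mem_left hμ)
    refine ⟨ε, hε, ?_⟩
    rw [← he, IndexTriple.pairForm, LinearMap.sum_apply]
    refine Finset.sum_eq_single_of_mem μ (Finset.mem_univ _) fun ν _ hν => ?_
    -- A different choice takes some `B_l` in place of `A_l`; the entries of `B` reserved for the
    -- `αᵢ` are absent in any case.
    obtain ⟨l, hl⟩ := hμ' ν hν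
    refine hz 0 1 ν (Fin.castAdd 2 l) (Fin.natAdd m 0)
      (D.A_notMem_indices _ ?_ ?_ fun l' => D.β_ne_A hl rfl)
      (D.B_notMem_indices _ ?_ ?_ fun l => D.β_ne_B_last _ _ _)
    · exact fun h => castAdd_ne_natAdd _ _ (hA h).symm
    · exact fun h => castAdd_ne_natAdd _ _ (hA h).symm
    · exact hAB _ _
    · exact hAB _ _
  have h23 : ∃ ε : k, ε * ε = 1 ∧ D.triple.pairForm k 2 3 ω = ε * coordinate k t ω := by
    obtain ⟨μ, hμ, hμ'⟩ := D.exists_choice_right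
    obtain ⟨ε, hε, he⟩ := exists_sign_of_forall_mem_range (k := k)
      (IndexTriple.indices_injective D.allIndices_injective (by decide) μ) (D.indices_mem_right hμ)
    refine ⟨ε, hε, ?_⟩
    rw [← he, IndexTriple.pairForm, LinearMap.sum_apply]
    refine Finset.sum_eq_single_of_mem μ (Finset.mem_univ _) fun ν _ hν => ?_
    obtain ⟨l, hl⟩ := hμ' ν hν
    refine hz 2 3 ν (Fin.natAdd m 0) (Fin.castAdd 2 l)
      (D.A_notMem_indices _ ?_ ?_ fun l => D.β_ne_A_last _ _ _)
      (D.B_notMem_indices _ ?_ ?_ fun l' => D.β_ne_B hl rfl)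
    · exact hBA _ _
    · exact hBA _ _
    · exact fun h => castAdd_ne_natAdd _ _ (hB h).symm
    · exact fun h => castAdd_ne_natAdd _ _ (hB h).symm
  obtain ⟨ε, hε, h01⟩ := h01
  obtain ⟨δ, hδ, h23⟩ := h23
  have key := D.form_triple_eq_zero hω
  rw [IndexTriple.form_apply, h02, h03, h01, h23] at key
  -- The signs are removed by `ε² = δ² = 1`.
  linear_combination ε * δ * key - coordinate k s ω * coordinate k t ω * (δ * δ * hε + hδ)

end Splitting

/-! ### Distances between index sequences -/

section Distance

variable {k : Type*} [Field k] {p n : ℕ}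

theorem indexDist_le_one_of_forall {s w : Fin p → Fin n} (hw : Function.Injective w) {x : Fin n}
    (h : ∀ c, w c ∉ Set.range s → w c = x) : indexDist s w ≤ 1 := by
  rw [indexDist, Set.ncard_le_one (Set.toFinite _)]
  exact fun c hc d hd => hw ((h c hc).trans (h d hd).symm)

theorem indexDist_update_update_le (s : Fin p → Fin n) (a b : Fin p) (x y : Fin n) :
    indexDist s (Function.update (Function.update s a x) b y) ≤ 2 := by
  refine (Set.ncard_le_ncard (t := {a, b}) (fun c hc => ?_) (Set.toFinite _)).trans
    ((Set.ncard_insert_le _ _).trans (by simp))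
  by_contra hc'
  simp only [Set.mem_insert_iff, Set.mem_singleton_iff, not_or] at hc'
  refine hc ⟨c, ?_⟩
  rw [Function.update_of_ne hc'.2, Function.update_of_ne hc'.1]

theorem indexDist_update_lt {s t : Fin p → Fin n} {a b : Fin p} (ha : s a ∉ Set.range t)
    (hb : t b ∉ Set.range s) : indexDist (Function.update s a (t b)) t < indexDist s t := by
  refine Set.ncard_lt_ncard ⟨fun c hc hcs => hc ?_, fun h => h hb ⟨a, ?_⟩⟩ (Set.toFinite _)
  · obtain ⟨e, he⟩ := hcs
    refine ⟨e, ?_⟩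
    rw [Function.update_of_ne, he]
    rintro rfl
    exact ha ⟨c, he.symm⟩
  · simp

theorem exists_update_of_indexDist_le_one (hp : 1 ≤ p) {s t : Fin p → Fin n}
    (hs : Function.Injective s) (h : indexDist s t ≤ 1) :
    ∃ a x, ∀ c, t c ∈ Set.range (Function.update s a x) := by
  by_cases hb : ∀ c, t c ∈ Set.range s
  · refine ⟨⟨0, hp⟩, s ⟨0, hp⟩, ?_⟩
    rwa [Function.update_eq_self]
  push Not at hb
  obtain ⟨b, hb⟩ := hb
  obtain ⟨a, ha⟩ := exists_notMem_range hs hb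
  refine ⟨a, t b, fun c => ?_⟩
  by_cases hc : t c ∈ Set.range s
  · obtain ⟨e, he⟩ := hc
    refine ⟨e, ?_⟩
    rw [Function.update_of_ne, he]
    rintro rfl
    exact ha ⟨c, he.symm⟩
  · rw [indexDist, Set.ncard_le_one (Set.toFinite _)] at h
    rw [h c hc b hb]
    exact ⟨a, by simp⟩

theorem coordinate_eq_of_forall_mem_range {ω η : ⋀[k]^p (Fin n → k)} {w s : Fin p → Fin n}
    (hw : Function.Injective w) (h : ∀ c, w c ∈ Set.range s)
    (hs : coordinate k s ω = coordinate k s η) : coordinate k w ω = coordinate k w η := by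
  obtain ⟨ε, -, he⟩ := exists_sign_of_forall_mem_range (k := k) hw h
  rw [he, he, hs]

/-- The three-term relations determine the coordinates at distance two. -/
theorem coordinate_eq_of_indexDist_eq_two {ω η : ⋀[k]^p (Fin n → k)}
    (hω : ∀ Q ∈ rankSixForms k p n, Q ω = 0) (hη : ∀ Q ∈ rankSixForms k p n, Q η = 0)
    {s t : Fin p → Fin n} (h0 : coordinate k s ω ≠ 0) (ht : Function.Injective t)
    (h2 : indexDist s t = 0 + 2) (h : ∀ w : Fin p → Fin n, Function.Injective w →
      indexDist s w ≤ 1 → coordinate k w ω = coordinate k w η) :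
    coordinate k t ω = coordinate k t η := by
  have hs := coordinate_injective_of_ne_zero h0
  obtain ⟨D⟩ := exists_splitting hs ht h2
  obtain ⟨α0, α1, α2, α3⟩ := D.α_values
  have hinj := fun {i j} (hij : i ≠ j) μ =>
    IndexTriple.indices_injective D.allIndices_injective (i := i) (j := j) hij μ
  -- Here `m = 0`: there are no pairs `β`, and each `πᵢⱼ` is a single coordinate.
  have hμ : ∀ (μ : Fin D.triple.m → Fin 2) (l : Fin D.triple.m), False := fun _ l => l.elim0
  have hdist : ∀ i j μ, (∃ q, D.triple.α i = D.A q) → i ≠ j →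
      indexDist s (D.triple.indices i j μ) ≤ 1 := by
    rintro i j μ ⟨q, hq⟩ hij
    refine indexDist_le_one_of_forall (hinj hij μ) (x := D.triple.α j) fun c hc => ?_
    rw [D.mem_left] at hc
    push Not at hc
    rcases D.triple.mem_range_indices.mp ⟨c, rfl⟩ with h | h | ⟨l, h⟩ | ⟨l, h⟩
    · exact absurd (h.trans hq) (hc.1 q)
    · exact h
    · exact (hμ μ l).elim
    · exact absurd h (hc.2 l)
  have hpair : ∀ i j, (∃ q, D.triple.α i = D.A q) → i ≠ j →
      D.triple.pairForm k i j ω = D.triple.pairForm k i j η := by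
    intro i j hi hij
    rw [IndexTriple.pairForm, LinearMap.sum_apply, LinearMap.sum_apply]
    exact Finset.sum_congr rfl fun μ _ => h _ (hinj hij μ) (hdist i j μ hi hij)
  have hsingle : ∀ i j (ξ : ⋀[k]^p (Fin n → k)), D.triple.pairForm k i j ξ
      = coordinate k (D.triple.indices i j 0) ξ := by
    intro i j ξ
    rw [IndexTriple.pairForm, LinearMap.sum_apply]
    refine Finset.sum_eq_single_of_mem 0 (Finset.mem_univ _) fun μ _ hne => ?_
    exact absurd (funext fun l => (hμ μ l).elim) hne
  have e1 := D.form_triple_eq_zero hω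
  have e2 := D.form_triple_eq_zero hη
  rw [IndexTriple.form_apply] at e1 e2
  -- Of the six coordinates only the one indexed by `t` is not within distance one of `s`; its
  -- cofactor is `± Π_s ≠ 0`.
  rw [← hpair 0 1 ⟨_, α0⟩ (by decide), ← hpair 0 2 ⟨_, α0⟩ (by decide),
    ← hpair 0 3 ⟨_, α0⟩ (by decide), ← hpair 1 2 ⟨_, α1⟩ (by decide),
    ← hpair 1 3 ⟨_, α1⟩ (by decide)] at e2
  obtain ⟨ε, hε, he⟩ := exists_sign_of_forall_mem_range (k := k) (hinj (by decide) 0)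
    (D.indices_mem_left (μ := 0) fun l => (hμ 0 l).elim)
  obtain ⟨δ, hδ, hd⟩ := exists_sign_of_forall_mem_range (k := k) (hinj (by decide) 0)
    (D.indices_mem_right (μ := 0) fun l => (hμ 0 l).elim)
  rw [hsingle 0 1, hsingle 2 3, he, hd] at e1 e2
  refine mul_left_cancel₀ h0 ?_
  linear_combination ε * δ * (e1 - e2) - (coordinate k s ω * coordinate k t ω
    - coordinate k s ω * coordinate k t η) * (δ * δ * hε + hδ)

end Distance

/-! ### The forms of rank six determine all coordinates -/

section RankSix

variable {k : Type*} [Field k] {p n : ℕ}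

/-- Both `s` and `η` vary in the induction, since the base point may move towards `t`. -/
theorem coordinate_eq_of_rankSixForms (hp : 1 ≤ p) {ω : ⋀[k]^p (Fin n → k)}
    (hω : ∀ Q ∈ rankSixForms k p n, Q ω = 0) (d : ℕ) :
    ∀ (s : Fin p → Fin n) (η : ⋀[k]^p (Fin n → k)), coordinate k s ω ≠ 0 → IsDecomposable η →
      (∀ a x, coordinate k (Function.update s a x) η
        = coordinate k (Function.update s a x) ω) →
      ∀ t, indexDist s t = d → coordinate k t ω = coordinate k t η := by
  induction d using Nat.strong_induction_on with
  | _ d ih =>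
    intro s η h0 hη hη' t hd
    by_cases ht : Function.Injective t
    swap
    · simp only [coordinate_apply_of_not_injective ht]
    have hs := coordinate_injective_of_ne_zero h0
    have near : ∀ w, Function.Injective w → indexDist s w ≤ 1 →
        coordinate k w ω = coordinate k w η := by
      intro w hw h1
      obtain ⟨a, x, hax⟩ := exists_update_of_indexDist_le_one hp hs h1
      exact coordinate_eq_of_forall_mem_range hw hax (hη' a x).symm
    rcases le_or_gt d 1 with hd1 | hd1
    · exact near t ht (hd.trans_le hd1)
    rcases Nat.eq_or_lt_of_le hd1 with hd2 | hd2
    · refine coordinate_eq_of_indexDist_eq_two hω (fun Q hQ => ?_) h0 ht (hd.trans hd2.symm) near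
      obtain ⟨T, -, rfl⟩ := hQ
      exact T.form_eq_zero_of_isDecomposable hη
    by_cases hu : ∃ a b, s a ∉ Set.range t ∧ t b ∉ Set.range s ∧
        coordinate k (Function.update s a (t b)) ω ≠ 0
    · obtain ⟨a, b, ha, hb, hu⟩ := hu
      obtain ⟨ξ, hξ, hξ'⟩ := exists_isDecomposable_forall_update hp hu
      have h1 := ih _ (hd ▸ indexDist_update_lt ha hb) _ ξ hu hξ hξ' t rfl
      have h2 : ξ = η := by
        -- Near the new base point, `ξ` agrees with `ω` by choice and `ω` agrees with `η` by
        -- induction, as these sequences lie within distance `2 < d` of `s`. Two decomposable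
        -- elements agreeing there are equal.
        refine hξ.satisfiesExchange.eq_of_forall_update (s := Function.update s a (t b))
          hη.satisfiesExchange ?_ ?_ fun c x => ?_
        · have := hξ' a (t b)
          rw [Function.update_idem] at this
          rwa [this]
        · have := hξ' a (t b)
          rw [Function.update_idem] at this
          rw [this, hη']
        · rw [hξ']
          exact ih _ ((indexDist_update_update_le s a c (t b) x).trans_lt hd2) s η h0 hη hη' _ rfl
      rw [h1, h2]
    · push Not at hu
      -- Exchange the entry of `s` missing from `w`: each incoming entry either repeats one of `s`
      -- or gives a neighbour of `s` towards `t`, whose coordinate vanishes.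
      have hz : ∀ w, Function.Injective w → (∀ c, w c ∈ Set.range s ∨ w c ∈ Set.range t) →
          (∃ x ∈ Set.range s, x ∉ Set.range t ∧ x ∉ Set.range w) → coordinate k w η = 0 := by
        rintro w hw hst ⟨x, ⟨a, rfl⟩, hat, haw⟩
        have h1 := hη.exchange s w a
        have h2 : coordinate k s η = coordinate k s ω := by
          have := hη' a (s a)
          rwa [Function.update_eq_self] at this
        rw [Finset.sum_eq_zero, h2] at h1
        · exact (mul_eq_zero.mp h1).resolve_left h0
        intro c _
        by_cases hc : w c ∈ Set.range s
        · obtain ⟨e, he⟩ := hc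
          rw [← he, coordinate_update_eq_zero, zero_mul]
          rintro rfl
          exact haw ⟨c, he.symm⟩
        · obtain ⟨b, hb⟩ := (hst c).resolve_left hc
          rw [← hb] at hc
          rw [← hb, hη', hu a b hat hc, zero_mul]
      obtain ⟨D⟩ := exists_splitting hs ht (m := d - 2) (by omega)
      -- A sequence omitting an entry peculiar to `t` is closer to `s`, so by induction its
      -- coordinate at `ω` equals the one at `η`, which is zero.
      have h3 := D.coordinate_mul_eq_zero hω fun w hst hx hy => by
        by_cases hw : Function.Injective w
        swap
        · exact coordinate_apply_of_not_injective hw ω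
        rw [← hz w hw hst hx]
        obtain ⟨y, ⟨b, rfl⟩, hb, hbw⟩ := hy
        refine ih _ ?_ s η h0 hη hη' w rfl
        rw [← hd]
        refine indexDist_lt hb hw fun c hc => ?_
        obtain ⟨e, he⟩ := (hst c).resolve_left hc
        refine ⟨e, ?_, he⟩
        rintro rfl
        exact hbw ⟨c, he.symm⟩
      rw [(mul_eq_zero.mp h3).resolve_left h0]
      exact (hz t ht (fun c => Or.inr ⟨c, rfl⟩)
        ⟨_, D.A_mem 0, D.A_notMem 0, D.A_notMem 0⟩).symm

/-- The forms of rank six cut out the Grassmann cone. -/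
theorem isDecomposable_iff_rankSixForms (hp : 1 ≤ p) (ω : ⋀[k]^p (Fin n → k)) :
    IsDecomposable ω ↔ ∀ Q ∈ rankSixForms k p n, Q ω = 0 := by
  constructor
  · rintro hω Q ⟨T, -, rfl⟩
    exact T.form_eq_zero_of_isDecomposable hω
  · intro hω
    by_cases h0 : ω = 0
    · rw [h0]
      exact isDecomposable_zero hp
    obtain ⟨s, -, hs⟩ := exists_coordinate_ne_zero h0
    obtain ⟨η, hη, he⟩ := exists_isDecomposable_forall_update hp hs
    rw [ext_coordinate fun i _ => coordinate_eq_of_rankSixForms hp hω _ s η hs hη he i rfl]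
    exact hη

end RankSix

end GrassmannCone

theorem mainTheorem1 {k : Type*} [Field k] (p n : ℕ) (hp : 1 ≤ p) :
    (GrassmannCone.rankSixForms k p n).Finite ∧
    (∀ Q ∈ GrassmannCone.rankSixForms k p n,
      GrassmannCone.formRank Q = 6 ∧
      ∃ G : ⋀[k]^p (Fin n → k) →ₗ[k] ⋀[k]^2 (Fin 4 → k),
        GrassmannCone.PreservesGrassmannCone G ∧
        Q = (GrassmannCone.threeTermPlucker k).comp G) ∧
    (∀ ω : ⋀[k]^p (Fin n → k),
      GrassmannCone.IsDecomposable ω ↔ ∀ Q ∈ GrassmannCone.rankSixForms k p n, Q ω = 0) ∧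
    (∀ ω : ⋀[k]^p (Fin n → k),
      GrassmannCone.IsDecomposable ω ↔ ∀ Q ∈ GrassmannCone.pluckerRelations k p n, Q ω = 0) := by
  refine ⟨GrassmannCone.finite_rankSixForms k p n, ?_,
    GrassmannCone.isDecomposable_iff_rankSixForms hp,
    GrassmannCone.isDecomposable_iff_pluckerRelations hp⟩
  rintro Q ⟨T, hT, rfl⟩
  exact ⟨GrassmannCone.IndexTriple.formRank_form hT.distinct, _, T.preservesGrassmannCone,
    T.form_eq_comp⟩
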